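/- Let $M$ be a complete open (that is, connected, non-compact, without boundary) smooth Riemannian $n$-manifold and let $p\in M$ be any point. Then there exists a locally Lipschitz function $G:[0,\infty)\to\mathbb{R}$ such that the radial curvature of $M$ at $p$ is bounded from below by that of a non-compact model surface of revolution $(\widetilde M,\tilde p)$ with radial curvature function $G$. Here a non-compact model surface of revolution is a complete $2$-dimensional Riemannian manifold $\widetilde M$ with base point $\tilde p$ whose metric is expressed in geodesic polar coordinates around $\tilde p$ as $$d\tilde s^2=dt^2+f(t)^2\,d\theta^2,\qquad (t,\theta)\in(0,\infty)\times\mathbb{S}^1,$$ where $f:(0,\infty)\to\mathbb{R}$ is a positive smooth function that extends to a smooth odd function around $0$. Its radial curvature function is $t\mapsto K_{\widetilde M}(\tilde\gamma(t))$, $t\in[0,\infty)$, where $K_{\widetilde M}$ is the Gaussian curvature and $\tilde\gamma$ is any meridian emanating from $\tilde p=\tilde\gamma(0)$. The radial curvature of $M$ at $p$ is bounded from below by that of $(\widetilde M,\tilde p)$ if, along every unit speed minimal geodesic $\gamma:[0,a)\to M$ with $\gamma(0)=p$, the sectional curvature $K_M$ of $M$ satisfies $K_M(\sigma_t)\ge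 G(t)$ for all $t\in[0,a)$ and all $2$-dimensional linear subspaces $\sigma_t\subset T_{\gamma(t)}M$ spanned by $\gamma'(t)$ and a tangent vector to $M$ at $\gamma(t)$. -/

import Mathlib

open Set Manifold Bundle
open scoped ContDiff

noncomputable section

namespace RadialCurvature

/-! ### Sectional curvature of a Riemannian manifold, in charts -/

section Curvature

variable {n : ℕ} {M : Type*} [TopologicalSpace M] [ChartedSpace (EuclideanSpace ℝ (Fin n)) M]
  [IsManifold (𝓡 n) ∞ M] [RiemannianBundle (fun x : M => TangentSpace (𝓡 n) x)]

/-- The Riemannian metric read in the preferred chart `φ` around `x₀`: at a point `y` of the target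
of `φ` this is the bilinear form `(u, v) ↦ ⟪D(φ⁻¹)(y) u, D(φ⁻¹)(y) v⟫` on `ℝⁿ`. -/
def chartMetric (x₀ : M) (y : EuclideanSpace ℝ (Fin n)) :
    EuclideanSpace ℝ (Fin n) →L[ℝ] EuclideanSpace ℝ (Fin n) →L[ℝ] ℝ :=
  let D : EuclideanSpace ℝ (Fin n) →L[ℝ]
      TangentSpace (𝓡 n) ((extChartAt (𝓡 n) x₀).symm y) :=
    mfderiv (𝓡 n) (𝓡 n) (extChartAt (𝓡 n) x₀).symm y
  (innerSL ℝ (E := TangentSpace (𝓡 n) ((extChartAt (𝓡 n) x₀).symm y))).bilinearComp D D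

theorem chartMetric_apply (x₀ : M) (y u v : EuclideanSpace ℝ (Fin n)) :
    chartMetric x₀ y u v =
      inner ℝ (mfderiv (𝓡 n) (𝓡 n) (extChartAt (𝓡 n) x₀).symm y u)
        (mfderiv (𝓡 n) (𝓡 n) (extChartAt (𝓡 n) x₀).symm y v) :=
  rfl

/-- The Christoffel symbols in the chart around `x₀`, as a vector-valued bilinear map: with `g` the
metric in the chart, `Γ(u, v)` is the vector with
`2 g(Γ(u, v), w) = (∂ᵤ g)(v, w) + (∂ᵥ g)(u, w) - (∂_w g)(u, v)` for all `w`. In coordinates this is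
`Γᵏᵢⱼ = ½ gᵏˡ (∂ᵢ gⱼₗ + ∂ⱼ gᵢₗ - ∂ₗ gᵢⱼ)`. -/
def chartChristoffel (x₀ : M) (y u v : EuclideanSpace ℝ (Fin n)) : EuclideanSpace ℝ (Fin n) :=
  let Dg := fderiv ℝ (chartMetric x₀) y
  (1 / 2 : ℝ) • (chartMetric x₀ y).inverse (Dg u v + Dg v u - (Dg.flip u).flip v)

/-- The Riemann curvature tensor `R(u, v) w = ∇ᵤ ∇ᵥ w - ∇ᵥ ∇ᵤ w` (for constant fields `u, v, w` in
the chart around `x₀`) of the Levi-Civita connection. -/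
def chartCurvature (x₀ : M) (y u v w : EuclideanSpace ℝ (Fin n)) : EuclideanSpace ℝ (Fin n) :=
  fderiv ℝ (fun z => chartChristoffel x₀ z v w) y u
    - fderiv ℝ (fun z => chartChristoffel x₀ z u w) y v
    + chartChristoffel x₀ y u (chartChristoffel x₀ y v w)
    - chartChristoffel x₀ y v (chartChristoffel x₀ y u w)

/-- The sectional curvature `⟪R(u, v) v, u⟫ / (‖u‖² ‖v‖² - ⟪u, v⟫²)` at `x` of the plane spanned by
two linearly independent tangent vectors `u`, `v`. -/
def sectionalCurvature (x : M) (u v : TangentSpace (𝓡 n) x) : ℝ :=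
  let y : EuclideanSpace ℝ (Fin n) := extChartAt (𝓡 n) x x
  let u' : EuclideanSpace ℝ (Fin n) := mfderiv (𝓡 n) (𝓡 n) (extChartAt (𝓡 n) x) x u
  let v' : EuclideanSpace ℝ (Fin n) := mfderiv (𝓡 n) (𝓡 n) (extChartAt (𝓡 n) x) x v
  chartMetric x y (chartCurvature x y u' v' v') u' /
    (chartMetric x y u' u' * chartMetric x y v' v' - chartMetric x y u' v' ^ 2)

end Curvature

/-! ### Radial curvature bounds -/

section Radial

/-- The velocity `γ'(t)` of a curve defined on `[0, a)` (one-sided at `t = 0`). -/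
def velocity (n : ℕ) {M : Type*} [TopologicalSpace M] [ChartedSpace (EuclideanSpace ℝ (Fin n)) M]
    (γ : ℝ → M) (a t : ℝ) : TangentSpace (𝓡 n) (γ t) :=
  mfderivWithin 𝓘(ℝ, ℝ) (𝓡 n) γ (Ico 0 a) t (1 : ℝ)

/-- `γ : [0, a) → M` is a unit speed minimal geodesic: a smooth unit speed curve each of whose arcs
realizes the distance between its endpoints. -/
structure IsUnitSpeedMinimalGeodesic (n : ℕ) {M : Type*} [MetricSpace M]
    [ChartedSpace (EuclideanSpace ℝ (Fin n)) M] [IsManifold (𝓡 n) ∞ M]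
    [RiemannianBundle (fun x : M => TangentSpace (𝓡 n) x)] (γ : ℝ → M) (a : ℝ) : Prop where
  pos : 0 < a
  smooth : ContMDiffOn 𝓘(ℝ, ℝ) (𝓡 n) ∞ γ (Ico 0 a)
  unit_speed : ∀ t ∈ Ico 0 a, ‖velocity n γ a t‖ = 1
  minimal : ∀ s ∈ Ico 0 a, ∀ t ∈ Ico 0 a, dist (γ s) (γ t) = |s - t|

/-- The radial curvature of `M` at `p` is bounded from below by the function `G` on `[0, ∞)`: along
every unit speed minimal geodesic `γ : [0, a) → M` from `p`, every tangent plane at `γ t` that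
contains `γ'(t)` has sectional curvature at least `G t`. -/
def RadialCurvatureBoundedBelow (n : ℕ) {M : Type*} [MetricSpace M]
    [ChartedSpace (EuclideanSpace ℝ (Fin n)) M] [IsManifold (𝓡 n) ∞ M]
    [RiemannianBundle (fun x : M => TangentSpace (𝓡 n) x)] (p : M) (G : ℝ → ℝ) : Prop :=
  ∀ (γ : ℝ → M) (a : ℝ), IsUnitSpeedMinimalGeodesic n γ a → γ 0 = p →
    ∀ t ∈ Ico 0 a, ∀ w : TangentSpace (𝓡 n) (γ t),
      LinearIndependent ℝ ![velocity n γ a t, w] →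
        G t ≤ sectionalCurvature (γ t) (velocity n γ a t) w

end Radial

/-! ### Non-compact model surfaces of revolution -/

section Model

variable {N : Type*} [TopologicalSpace N] [ChartedSpace (EuclideanSpace ℝ (Fin 2)) N]

/-- The point with polar coordinates `(t, θ)`, in the parametrization `Φ` of a surface by the
plane. -/
def polarMap (Φ : EuclideanSpace ℝ (Fin 2) → N) (t θ : ℝ) : N :=
  Φ !₂[t * Real.cos θ, t * Real.sin θ]

/-- The coordinate field `∂/∂t` of the polar coordinates. -/
def polarDt (Φ : EuclideanSpace ℝ (Fin 2) → N) (t θ : ℝ) :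
    TangentSpace (𝓡 2) (polarMap Φ t θ) :=
  mfderiv 𝓘(ℝ, ℝ) (𝓡 2) (fun s => polarMap Φ s θ) t (1 : ℝ)

/-- The coordinate field `∂/∂θ` of the polar coordinates. -/
def polarDθ (Φ : EuclideanSpace ℝ (Fin 2) → N) (t θ : ℝ) :
    TangentSpace (𝓡 2) (polarMap Φ t θ) :=
  mfderiv 𝓘(ℝ, ℝ) (𝓡 2) (fun η => polarMap Φ t η) θ (1 : ℝ)

variable [IsManifold (𝓡 2) ∞ N] [RiemannianBundle (fun x : N => TangentSpace (𝓡 2) x)]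

/-- The surface `N` with base point `q` has the metric `dt² + f(t)² dθ²` in the geodesic polar
coordinates `(t, θ) ∈ (0, ∞) × 𝕊¹` around `q` given by the diffeomorphism `Φ : ℝ² → N`, where `f` is
smooth, odd, and positive on `(0, ∞)`. (The metric forces the curves `t ↦ polarMap Φ t θ` to be
unit speed minimal geodesics from `q`, that is, the meridians.) -/
structure HasPolarMetric (q : N)
    (Φ : Diffeomorph (𝓡 2) (𝓡 2) (EuclideanSpace ℝ (Fin 2)) N ∞) (f : ℝ → ℝ) : Prop where
  base : Φ 0 = q
  smooth : ContDiff ℝ ∞ f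
  odd : ∀ t, f (-t) = -f t
  pos : ∀ t, 0 < t → 0 < f t
  metric_tt : ∀ t θ, 0 < t → inner ℝ (polarDt Φ t θ) (polarDt Φ t θ) = 1
  metric_tθ : ∀ t θ, 0 < t → inner ℝ (polarDt Φ t θ) (polarDθ Φ t θ) = 0
  metric_θθ : ∀ t θ, 0 < t → inner ℝ (polarDθ Φ t θ) (polarDθ Φ t θ) = f t ^ 2

/-- `(N, q)`, assumed to be complete, is a non-compact model surface of revolution with radial
curvature function `G`: it has a metric `dt² + f(t)² dθ²` in geodesic polar coordinates around `q`,
and `G t`, `t ≥ 0`, is the Gaussian curvature (the sectional curvature of the tangent plane) at the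
point at parameter `t` of any meridian. -/
def IsModelSurfaceWithRadialCurvature (q : N) (G : ℝ → ℝ) : Prop :=
  ∃ (Φ : Diffeomorph (𝓡 2) (𝓡 2) (EuclideanSpace ℝ (Fin 2)) N ∞) (f : ℝ → ℝ),
    HasPolarMetric q Φ f ∧
    ∀ t θ, 0 ≤ t → ∀ u v : TangentSpace (𝓡 2) (polarMap Φ t θ), LinearIndependent ℝ ![u, v] →
      sectionalCurvature (polarMap Φ t θ) u v = G t

end Model

end RadialCurvature

end

/-!
The radial curvature of `M` at `p` only involves the points `γ t` of minimal geodesics from `p`, and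
such a point is at distance `t` from `p`. So the statement splits into a lower bound for the
sectional curvature of `M` at these points in terms of `t`, and the construction of a model surface
whose curvature at distance `t` lies below any prescribed locally bounded function of `t`.

*The bound on `M`.* Near each point the sectional curvature of all tangent planes is bounded below
(`LocalMetric.IsMetricOn.exists_le_sectional`). The chart in which the curvature of `M` at `x` is
computed depends on `x` in an arbitrary way, so this needs the invariance of the curvature tensor
under changes of coordinates (`LocalMetric.IsLocalIsometryOn.curvature_eq`), which follows from the
transformation law of the Christoffel symbols. The points `γ t` with `t ≤ r` form a relatively
compact set (`RadialCurvature.isCompact_closure_geodesicBall`). This does not require the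
Hopf-Rinow theorem: a point `γ t` is within `ε` of `γ (t - ε)`, hence the set of `r` for which
relative compactness holds is closed, by completeness, and open, by local compactness.

*The model.* On the plane, the metric `|dx|² + e(|x|²) (x₀ dx₁ - x₁ dx₀)²` is smooth for every
smooth function `e`, and it is complete for `e ≥ 0`, being at least the Euclidean one. In polar
coordinates it is `dt² + f(t)² dθ²` with `f(t)² = t² (1 + t² e(t²))`, and taking `e = 2a + s a²`
gives `f(t) = t b(t²)` with `b(s) = 1 + s a(s)`. The invariance of the curvature under the polar
coordinates map shows that its Gaussian curvature is `-f'' / f = -(6 b' + 4 s b'') / b` at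
`s = t²`, also at the origin by continuity. For `a = exp A` with `A`, `A'` large and `A'' ≥ 0` this
is as negative as desired (`RadialCurvature.Profile.exists_curv_le`).
-/

section

open Filter Topology

-- spaces of trilinear maps are normed spaces only for instance search at this depth
set_option maxSynthPendingDepth 3

/-! ### Riemannian metrics on open subsets of a vector space -/

namespace LocalMetric

theorem minSmoothness_le_infty : minSmoothness ℝ 2 ≤ ∞ := by
  rw [minSmoothness_of_isRCLikeNormedField]
  exact WithTop.coe_le_coe.2 le_top

variable {E : Type*} [NormedAddCommGroup E] [NormedSpace ℝ E]

/-- `g` is a smooth Riemannian metric on the open subset `U` of the vector space `E`. -/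
structure IsMetricOn (g : E → E →L[ℝ] E →L[ℝ] ℝ) (U : Set E) : Prop where
  isOpen : IsOpen U
  contDiffOn : ContDiffOn ℝ ∞ g U
  symm : ∀ z ∈ U, ∀ u v, g z u v = g z v u
  pos : ∀ z ∈ U, ∀ u, u ≠ 0 → 0 < g z u u

/-- The Christoffel symbols `Γ(u, v)` of the metric `g` on a vector space. -/
noncomputable def christoffel (g : E → E →L[ℝ] E →L[ℝ] ℝ) (y u v : E) : E :=
  (1 / 2 : ℝ) • (g y).inverse
    (fderiv ℝ g y u v + fderiv ℝ g y v u - ((fderiv ℝ g y).flip u).flip v)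

/-- The curvature tensor `R(u, v) w` of the metric `g` on a vector space. -/
noncomputable def curvature (g : E → E →L[ℝ] E →L[ℝ] ℝ) (y u v w : E) : E :=
  fderiv ℝ (fun z => christoffel g z v w) y u - fderiv ℝ (fun z => christoffel g z u w) y v
    + christoffel g y u (christoffel g y v w) - christoffel g y v (christoffel g y u w)

/-- The sectional curvature of the metric `g` on a vector space, for the plane spanned by `u`
and `v`. -/
noncomputable def sectional (g : E → E →L[ℝ] E →L[ℝ] ℝ) (y u v : E) : ℝ :=
  g y (curvature g y u v v) u / (g y u u * g y v v - g y u v ^ 2)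

/-- The Christoffel symbols at `y`, as a continuous bilinear map. -/
noncomputable def christoffelMap (g : E → E →L[ℝ] E →L[ℝ] ℝ) (y : E) : E →L[ℝ] E →L[ℝ] E :=
  (1 / 2 : ℝ) • (ContinuousLinearMap.compL ℝ E (E →L[ℝ] ℝ) E (g y).inverse).comp
    (fderiv ℝ g y + (fderiv ℝ g y).flip -
      (ContinuousLinearMap.flipₗᵢ ℝ E E ℝ : (E →L[ℝ] E →L[ℝ] ℝ) →L[ℝ] (E →L[ℝ] E →L[ℝ] ℝ)).comp
        (fderiv ℝ g y).flip)

theorem christoffelMap_apply (g : E → E →L[ℝ] E →L[ℝ] ℝ) (y u v : E) :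
    christoffelMap g y u v = christoffel g y u v := rfl

variable {g h : E → E →L[ℝ] E →L[ℝ] ℝ} {U V : Set E}

namespace IsMetricOn

theorem mono (hg : IsMetricOn g V) (hUV : U ⊆ V) (hU : IsOpen U) : IsMetricOn g U :=
  ⟨hU, hg.contDiffOn.mono hUV, fun z hz => hg.symm z (hUV hz), fun z hz => hg.pos z (hUV hz)⟩

theorem eq_of_forall (hg : IsMetricOn g U) {z : E} (hz : z ∈ U) {u v : E}
    (huv : ∀ w, g z u w = g z v w) : u = v := by
  by_contra hne
  have := hg.pos z hz (u - v) (sub_ne_zero.2 hne)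
  simp [huv] at this

theorem nonneg (hg : IsMetricOn g U) {z : E} (hz : z ∈ U) (u : E) : 0 ≤ g z u u := by
  by_cases hu : u = 0
  · simp [hu]
  · exact (hg.pos z hz u hu).le

theorem contDiffOn_fderiv (hg : IsMetricOn g U) : ContDiffOn ℝ ∞ (fderiv ℝ g) U :=
  hg.contDiffOn.fderiv_of_isOpen hg.isOpen (by simp)

theorem differentiableAt (hg : IsMetricOn g U) {z : E} (hz : z ∈ U) : DifferentiableAt ℝ g z :=
  (hg.contDiffOn.contDiffAt (hg.isOpen.mem_nhds hz)).differentiableAt (by simp)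

theorem fderiv_apply_apply (hg : IsMetricOn g U) {z : E} (hz : z ∈ U) (u v w : E) :
    fderiv ℝ (fun z => g z v w) z u = fderiv ℝ g z u v w := by
  have h := ((hg.differentiableAt hz).hasFDerivAt.clm_apply (hasFDerivAt_const v z)).clm_apply
    (hasFDerivAt_const w z)
  rw [h.fderiv]
  simp

theorem fderiv_symm (hg : IsMetricOn g U) {z : E} (hz : z ∈ U) (u v w : E) :
    fderiv ℝ g z u v w = fderiv ℝ g z u w v := by
  rw [← hg.fderiv_apply_apply hz, ← hg.fderiv_apply_apply hz]
  congr 1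
  apply Filter.EventuallyEq.fderiv_eq
  filter_upwards [hg.isOpen.mem_nhds hz] with x hx using hg.symm x hx v w

variable [FiniteDimensional ℝ E]

/-- A metric identifies the space with its dual. -/
theorem exists_equiv (hg : IsMetricOn g U) {z : E} (hz : z ∈ U) :
    ∃ e : E ≃L[ℝ] (E →L[ℝ] ℝ), (e : E →L[ℝ] (E →L[ℝ] ℝ)) = g z := by
  have hinj : Function.Injective (g z : E →ₗ[ℝ] (E →L[ℝ] ℝ)) := by
    intro u v huv
    exact hg.eq_of_forall hz fun w => DFunLike.congr_fun huv w
  have hdim : Module.finrank ℝ E = Module.finrank ℝ (E →L[ℝ] ℝ) := by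
    rw [← (LinearMap.toContinuousLinearMap : (E →ₗ[ℝ] ℝ) ≃ₗ[ℝ] _).finrank_eq]
    exact (Subspace.dual_finrank_eq (K := ℝ) (V := E)).symm
  refine ⟨(LinearEquiv.ofInjectiveOfFinrankEq (g z : E →ₗ[ℝ] (E →L[ℝ] ℝ)) hinj
    hdim).toContinuousLinearEquiv, ?_⟩
  ext u v
  rfl

theorem apply_inverse (hg : IsMetricOn g U) {z : E} (hz : z ∈ U) (l : E →L[ℝ] ℝ) :
    g z ((g z).inverse l) = l := by
  obtain ⟨e, he⟩ := hg.exists_equiv hz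
  rw [← he, ContinuousLinearMap.inverse_equiv]
  simp

theorem apply_christoffel (hg : IsMetricOn g U) {z : E} (hz : z ∈ U) (u v w : E) :
    2 * g z (christoffel g z u v) w =
      fderiv ℝ g z u v w + fderiv ℝ g z v u w - fderiv ℝ g z w u v := by
  simp only [christoffel, map_smul, hg.apply_inverse hz]
  simp

theorem contDiffOn_christoffelMap (hg : IsMetricOn g U) :
    ContDiffOn ℝ ∞ (christoffelMap g) U := by
  have : CompleteSpace E := FiniteDimensional.complete ℝ E
  have h1 : ContDiffOn ℝ ∞ (fun z => (g z).inverse) U := by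
    intro z hz
    obtain ⟨e, he⟩ := hg.exists_equiv hz
    have := contDiffAt_map_inverse (n := ∞) e
    rw [he] at this
    exact this.comp_contDiffWithinAt z (hg.contDiffOn z hz)
  have h2 := hg.contDiffOn_fderiv
  have h3 : ContDiffOn ℝ ∞ (fun z => (fderiv ℝ g z).flip) U :=
    (ContinuousLinearMap.flipₗᵢ ℝ E E (E →L[ℝ] ℝ)).toContinuousLinearEquiv.contDiff.comp_contDiffOn
      h2
  unfold christoffelMap
  refine ContDiffOn.const_smul _ (ContDiffOn.clm_comp ?_ ?_)
  · exact (ContinuousLinearMap.contDiff _).comp_contDiffOn h1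
  · exact (h2.add h3).sub (contDiffOn_const.clm_comp h3)

theorem differentiableAt_christoffel (hg : IsMetricOn g U) {z : E} (hz : z ∈ U) (u v : E) :
    DifferentiableAt ℝ (fun z => christoffel g z u v) z := by
  have h1 : DifferentiableAt ℝ (christoffelMap g) z :=
    (hg.contDiffOn_christoffelMap.contDiffAt (hg.isOpen.mem_nhds hz)).differentiableAt (by simp)
  exact (h1.clm_apply (differentiableAt_const u)).clm_apply (differentiableAt_const v)

/-- The connection is compatible with the metric. -/
theorem fderiv_eq_christoffel (hg : IsMetricOn g U) {z : E} (hz : z ∈ U) (u v w : E) :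
    fderiv ℝ g z u v w = g z (christoffel g z u v) w + g z v (christoffel g z u w) := by
  have h1 := hg.apply_christoffel hz u v w
  have h2 := hg.apply_christoffel hz u w v
  have h3 := hg.fderiv_symm hz u v w
  have h4 := hg.fderiv_symm hz v u w
  have h5 := hg.fderiv_symm hz w u v
  have h6 := hg.symm z hz v (christoffel g z u w)
  linarith

/-- The skew-symmetry of `R(u, v)`: the second derivatives `∂ᵤ ∂ᵥ g` and `∂ᵥ ∂ᵤ g` of the metric
coincide, and they differ by `g(R(u, v) w, w)` terms. -/
theorem curvature_apply_self (hg : IsMetricOn g U) {z : E} (hz : z ∈ U) (u v w : E) :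
    g z (curvature g z u v w) w = 0 := by
  have hf : ContDiffAt ℝ ∞ (fun x => g x w w) z :=
    (((hg.contDiffOn.contDiffAt (hg.isOpen.mem_nhds hz)).clm_apply contDiffAt_const).clm_apply
      contDiffAt_const)
  have hsymm := (hf.isSymmSndFDerivAt minSmoothness_le_infty).eq u v
  -- the second derivative of `x ↦ g x w w`, through the compatibility of the connection
  have key : ∀ u v : E, fderiv ℝ (fderiv ℝ (fun x => g x w w)) z u v =
      2 * (fderiv ℝ g z u (christoffel g z v w) w +
        g z (fderiv ℝ (fun x => christoffel g x v w) z u) w) := by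
    intro u v
    have hd : DifferentiableAt ℝ (fderiv ℝ (fun x => g x w w)) z :=
      (hf.fderiv_right (m := ∞) (by simp)).differentiableAt (by simp)
    have e1 : fderiv ℝ (fun x => fderiv ℝ (fun x => g x w w) x v) z u =
        fderiv ℝ (fderiv ℝ (fun x => g x w w)) z u v := by
      rw [(hd.hasFDerivAt.clm_apply (hasFDerivAt_const v z)).fderiv]
      simp
    have e2 : (fun x => fderiv ℝ (fun x => g x w w) x v) =ᶠ[𝓝 z]
        fun x => 2 * g x (christoffel g x v w) w := by
      filter_upwards [hg.isOpen.mem_nhds hz] with x hx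
      rw [hg.fderiv_apply_apply hx, hg.fderiv_eq_christoffel hx, hg.symm x hx w]
      ring
    rw [← e1, e2.fderiv_eq]
    have h3 := ((hg.differentiableAt hz).hasFDerivAt.clm_apply
      (hg.differentiableAt_christoffel hz v w).hasFDerivAt).clm_apply (hasFDerivAt_const w z)
    rw [(h3.const_mul 2).fderiv]
    simp
    ring
  rw [key, key, hg.fderiv_eq_christoffel hz, hg.fderiv_eq_christoffel hz] at hsymm
  simp only [curvature, map_add, map_sub, add_apply,
    sub_apply]
  have h4 := hg.symm z hz (christoffel g z u w) (christoffel g z v w)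
  linarith

/-- The form `g(R(u, v) v, u)` only depends on `v` modulo `u`. -/
theorem curvature_add_smul (hg : IsMetricOn g U) {z : E} (hz : z ∈ U) (u v : E) (c : ℝ) :
    g z (curvature g z u (v + c • u) (v + c • u)) u = g z (curvature g z u v v) u := by
  have e : ∀ a : E, curvature g z u (v + c • u) a = curvature g z u v a := by
    intro a
    have h1 : (fun x => christoffel g x (v + c • u) a) =
        fun x => christoffel g x v a + c • christoffel g x u a := by
      ext x
      simp only [← christoffelMap_apply, map_add, map_smul, add_apply,
        smul_apply]
    have h2 := (hg.differentiableAt_christoffel hz v a).hasFDerivAt.add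
      ((hg.differentiableAt_christoffel hz u a).hasFDerivAt.const_smul c)
    simp only [curvature, h1]
    erw [h2.fderiv]
    simp only [← christoffelMap_apply, map_add, map_smul, add_apply,
      smul_apply]
    abel
  have e2 : curvature g z u v (v + c • u) = curvature g z u v v + c • curvature g z u v u := by
    have h1 : ∀ b, (fun x => christoffel g x b (v + c • u)) =
        fun x => christoffel g x b v + c • christoffel g x b u := by
      intro b
      ext x
      simp only [← christoffelMap_apply, map_add, map_smul]
    have h2 := fun b => (hg.differentiableAt_christoffel hz b v).hasFDerivAt.add
      ((hg.differentiableAt_christoffel hz b u).hasFDerivAt.const_smul c)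
    simp only [curvature, h1]
    erw [(h2 v).fderiv, (h2 u).fderiv]
    simp only [← christoffelMap_apply, map_add, map_smul, add_apply,
      smul_apply, smul_add, smul_sub]
    abel
  rw [e, e2]
  simp [hg.curvature_apply_self hz]

end IsMetricOn

/-! ### Change of coordinates -/

/-- `φ` is a local isometry from `g` on `U` to `h` on `V`. -/
structure IsLocalIsometryOn (φ : E → E) (g h : E → E →L[ℝ] E →L[ℝ] ℝ) (U V : Set E) : Prop where
  source : IsMetricOn g U
  target : IsMetricOn h V
  contDiffOn : ContDiffOn ℝ ∞ φ U
  mapsTo : MapsTo φ U V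
  pullback : ∀ z ∈ U, ∀ u v, g z u v = h (φ z) (fderiv ℝ φ z u) (fderiv ℝ φ z v)

namespace IsLocalIsometryOn

variable {φ : E → E}

theorem contDiffAt (H : IsLocalIsometryOn φ g h U V) {z : E} (hz : z ∈ U) :
    ContDiffAt ℝ ∞ φ z := H.contDiffOn.contDiffAt (H.source.isOpen.mem_nhds hz)

theorem differentiableAt_fderiv (H : IsLocalIsometryOn φ g h U V) {z : E} (hz : z ∈ U) :
    DifferentiableAt ℝ (fderiv ℝ φ) z :=
  ((H.contDiffAt hz).fderiv_right (m := ∞) (by simp)).differentiableAt (by simp)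

theorem hasFDerivAt (H : IsLocalIsometryOn φ g h U V) {z : E} (hz : z ∈ U) :
    HasFDerivAt φ (fderiv ℝ φ z) z :=
  ((H.contDiffAt hz).differentiableAt (by simp)).hasFDerivAt

theorem fderiv_metric (H : IsLocalIsometryOn φ g h U V) {z : E} (hz : z ∈ U) (u v w : E) :
    fderiv ℝ g z u v w =
      fderiv ℝ h (φ z) (fderiv ℝ φ z u) (fderiv ℝ φ z v) (fderiv ℝ φ z w) +
      h (φ z) (fderiv ℝ (fderiv ℝ φ) z u v) (fderiv ℝ φ z w) +
      h (φ z) (fderiv ℝ φ z v) (fderiv ℝ (fderiv ℝ φ) z u w) := by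
  have e : (fun x => g x v w) =ᶠ[𝓝 z] fun x => h (φ x) (fderiv ℝ φ x v) (fderiv ℝ φ x w) := by
    filter_upwards [H.source.isOpen.mem_nhds hz] with x hx using H.pullback x hx v w
  have h1 := (H.target.differentiableAt (H.mapsTo hz)).hasFDerivAt.comp z (H.hasFDerivAt hz)
  have h2 := fun a => (H.differentiableAt_fderiv hz).hasFDerivAt.clm_apply (hasFDerivAt_const a z)
  have h3 := (h1.clm_apply (h2 v)).clm_apply (h2 w)
  rw [← H.source.fderiv_apply_apply hz, e.fderiv_eq]
  erw [h3.fderiv]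
  simp
  ring

variable [FiniteDimensional ℝ E]

theorem surjective (H : IsLocalIsometryOn φ g h U V) {z : E} (hz : z ∈ U) :
    Function.Surjective (fderiv ℝ φ z) := by
  have hinj : Function.Injective (fderiv ℝ φ z : E →ₗ[ℝ] E) := by
    intro u v huv
    refine H.source.eq_of_forall hz fun w => ?_
    rw [H.pullback z hz, H.pullback z hz]
    exact congrArg (fun a => h (φ z) a _) huv
  exact LinearMap.injective_iff_surjective.1 hinj

/-- The transformation law of the Christoffel symbols under a change of coordinates. -/
theorem christoffel_eq (H : IsLocalIsometryOn φ g h U V) {z : E} (hz : z ∈ U) (u v : E) :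
    fderiv ℝ φ z (christoffel g z u v) = fderiv ℝ (fderiv ℝ φ) z u v +
      christoffel h (φ z) (fderiv ℝ φ z u) (fderiv ℝ φ z v) := by
  have hφz := H.mapsTo hz
  refine H.target.eq_of_forall hφz fun w' => ?_
  obtain ⟨w, rfl⟩ := H.surjective hz w'
  rw [← H.pullback z hz, map_add, add_apply]
  have h1 := H.source.apply_christoffel hz u v w
  have h2 := H.target.apply_christoffel hφz (fderiv ℝ φ z u) (fderiv ℝ φ z v) (fderiv ℝ φ z w)
  rw [H.fderiv_metric hz, H.fderiv_metric hz, H.fderiv_metric hz] at h1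
  have hs := fun a b => ((H.contDiffAt hz).isSymmSndFDerivAt minSmoothness_le_infty).eq a b
  rw [hs v u, hs w u, hs w v] at h1
  have h3 := H.target.symm _ hφz (fderiv ℝ φ z v) (fderiv ℝ (fderiv ℝ φ) z u w)
  have h4 := H.target.symm _ hφz (fderiv ℝ φ z u) (fderiv ℝ (fderiv ℝ φ) z v w)
  linarith

/-- The curvature tensor is invariant under changes of coordinates: differentiating the
transformation law of the Christoffel symbols, the terms that are not tensorial are symmetric in
`u` and `v`. -/
theorem curvature_eq (H : IsLocalIsometryOn φ g h U V) {z : E} (hz : z ∈ U) (u v w : E) :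
    fderiv ℝ φ z (curvature g z u v w) =
      curvature h (φ z) (fderiv ℝ φ z u) (fderiv ℝ φ z v) (fderiv ℝ φ z w) := by
  have hφz := H.mapsTo hz
  set A := fderiv ℝ φ z with hA
  set B := fderiv ℝ (fderiv ℝ φ) z with hB
  have hA' := (H.differentiableAt_fderiv hz).hasFDerivAt
  have hsB : ∀ a b, B a b = B b a :=
    fun a b => ((H.contDiffAt hz).isSymmSndFDerivAt minSmoothness_le_infty).eq a b
  have hcd2 : ContDiffAt ℝ ∞ (fderiv ℝ φ) z := (H.contDiffAt hz).fderiv_right (by simp)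
  have hB' : DifferentiableAt ℝ (fderiv ℝ (fderiv ℝ φ)) z :=
    (hcd2.fderiv_right (m := ∞) (by simp)).differentiableAt (by simp)
  -- the third derivative of `φ` is symmetric
  have hC : fderiv ℝ (fderiv ℝ (fderiv ℝ φ)) z u v w = fderiv ℝ (fderiv ℝ (fderiv ℝ φ)) z v u w :=
    congrArg (fun l : E →L[ℝ] E => l w) ((hcd2.isSymmSndFDerivAt minSmoothness_le_infty).eq u v)
  have key : ∀ u v : E, B u (christoffel g z v w) +
      A (fderiv ℝ (fun x => christoffel g x v w) z u) =
      fderiv ℝ (fderiv ℝ (fderiv ℝ φ)) z u v w +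
      (fderiv ℝ (fun y => christoffel h y (A v) (A w)) (φ z) (A u)
        + christoffel h (φ z) (B u v) (A w) + christoffel h (φ z) (A v) (B u w)) := by
    intro u v
    have e : (fun x => fderiv ℝ φ x (christoffel g x v w)) =ᶠ[𝓝 z] fun x =>
        fderiv ℝ (fderiv ℝ φ) x v w +
          christoffelMap h (φ x) (fderiv ℝ φ x v) (fderiv ℝ φ x w) := by
      filter_upwards [H.source.isOpen.mem_nhds hz] with x hx using H.christoffel_eq hx v w
    have l1 := hA'.clm_apply (H.source.differentiableAt_christoffel hz v w).hasFDerivAt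
    have hΓ : DifferentiableAt ℝ (christoffelMap h) (φ z) :=
      (H.target.contDiffOn_christoffelMap.contDiffAt
        (H.target.isOpen.mem_nhds hφz)).differentiableAt (by simp)
    have l2 := hΓ.hasFDerivAt.comp z (H.hasFDerivAt hz)
    have l3 := fun a => hA'.clm_apply (hasFDerivAt_const a z)
    have l4 := (l2.clm_apply (l3 v)).clm_apply (l3 w)
    have l5 := (hB'.hasFDerivAt.clm_apply (hasFDerivAt_const v z)).clm_apply (hasFDerivAt_const w z)
    have l6 := (hΓ.hasFDerivAt.clm_apply (hasFDerivAt_const (A v) _)).clm_apply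
      (hasFDerivAt_const (A w) _)
    have l7 := (l5.add l4).congr_of_eventuallyEq e
    have l8 := congrArg (fun l : E →L[ℝ] E => l u) (l1.unique l7)
    have l9 : fderiv ℝ (fun y => christoffel h y (A v) (A w)) (φ z) (A u) =
        fderiv ℝ (christoffelMap h) (φ z) (A u) (A v) (A w) := by
      erw [l6.fderiv]
      simp
    rw [l9]
    simp [christoffelMap_apply, ← hA, ← hB] at l8
    rw [add_comm, l8]
    abel
  have hBA : ∀ a b, B a b = A (christoffel g z a b) - christoffel h (φ z) (A a) (A b) := by
    intro a b
    rw [H.christoffel_eq hz]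
    simp [← hB, ← hA]
  have k1 := key u v
  have k2 := key v u
  rw [hC] at k1
  have f1 : B u (christoffel g z v w) = A (christoffel g z u (christoffel g z v w)) -
      christoffel h (φ z) (A u) (B v w + christoffel h (φ z) (A v) (A w)) := by
    rw [hBA, ← H.christoffel_eq hz v w]
  have f2 : B v (christoffel g z u w) = A (christoffel g z v (christoffel g z u w)) -
      christoffel h (φ z) (A v) (B u w + christoffel h (φ z) (A u) (A w)) := by
    rw [hBA, ← H.christoffel_eq hz u w]
  rw [f1] at k1
  rw [f2, hsB v u] at k2
  simp only [← christoffelMap_apply, map_add] at k1 k2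
  simp only [← christoffelMap_apply, curvature, map_add, map_sub]
  have k3 := congrArg₂ (· - ·) k1 k2
  rw [← sub_eq_zero] at k3 ⊢
  rw [← k3]
  abel

theorem sectional_eq (H : IsLocalIsometryOn φ g h U V) {z : E} (hz : z ∈ U) (u v : E) :
    sectional g z u v = sectional h (φ z) (fderiv ℝ φ z u) (fderiv ℝ φ z v) := by
  unfold sectional
  rw [H.pullback z hz, H.curvature_eq hz, ← H.pullback z hz, ← H.pullback z hz,
    ← H.pullback z hz]

end IsLocalIsometryOn

end LocalMetric

/-! ### Bounds for the sectional curvature -/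

namespace LocalMetric

variable {E : Type*} [NormedAddCommGroup E] [NormedSpace ℝ E]
  {g : E → E →L[ℝ] E →L[ℝ] ℝ} {U : Set E}

namespace IsMetricOn

/-- A metric dominates a multiple of the norm, locally uniformly. -/
theorem exists_pos_le [FiniteDimensional ℝ E] (hg : IsMetricOn g U) {y : E} (hy : y ∈ U) :
    ∃ c > 0, ∀ᶠ z in 𝓝 y, ∀ u, c * ‖u‖ ^ 2 ≤ g z u u := by
  obtain ⟨c, hc, hcu⟩ : ∃ c > 0, ∀ u, ‖u‖ = 1 → 2 * c ≤ g y u u := by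
    have hcomp : IsCompact (Metric.sphere (0 : E) 1) := isCompact_sphere 0 1
    rcases (Metric.sphere (0 : E) 1).eq_empty_or_nonempty with hS | hS
    · refine ⟨1, one_pos, fun u hu => ?_⟩
      have : u ∈ Metric.sphere (0 : E) 1 := by simpa using hu
      simp [hS] at this
    · obtain ⟨u₀, hu₀, hmin⟩ := hcomp.exists_isMinOn hS (f := fun u => g y u u)
        (Continuous.continuousOn (by fun_prop))
      have hne : u₀ ≠ 0 := by
        rintro rfl
        simp at hu₀
      refine ⟨g y u₀ u₀ / 2, half_pos (hg.pos y hy u₀ hne), fun u hu => ?_⟩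
      have := hmin (show u ∈ Metric.sphere (0 : E) 1 by simpa using hu)
      simp only [mem_ofPred_eq] at this
      linarith
  refine ⟨c, hc, ?_⟩
  have hcont : ContinuousAt g y := (hg.differentiableAt hy).continuousAt
  filter_upwards [Metric.continuousAt_iff'.1 hcont c hc] with z hz u
  by_cases hu : u = 0
  · simp [hu]
  have hn : 0 < ‖u‖ := norm_pos_iff.2 hu
  have h1 : 2 * c * ‖u‖ ^ 2 ≤ g y u u := by
    have h := hcu (‖u‖⁻¹ • u) (by rw [norm_smul, norm_inv, norm_norm, inv_mul_cancel₀ hn.ne'])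
    simp only [map_smul, smul_apply, smul_eq_mul] at h
    have h' := mul_le_mul_of_nonneg_right h (sq_nonneg ‖u‖)
    refine h'.trans (le_of_eq ?_)
    field_simp
  have h2 : ‖g z u u - g y u u‖ ≤ c * ‖u‖ ^ 2 := by
    have h := (g z - g y).le_opNorm₂ u u
    rw [dist_eq_norm] at hz
    refine h.trans ?_
    rw [mul_assoc, ← pow_two]
    gcongr
  have h3 := neg_le_of_abs_le h2
  linarith

/-- The Gram determinant of `u` and `v`, in terms of the component of `v` orthogonal to `u`. -/
theorem gram_eq (hg : IsMetricOn g U) {z : E} (hz : z ∈ U) {u : E} (hu : u ≠ 0) (v : E) :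
    g z u u * g z v v - g z u v ^ 2 = g z u u *
      g z (v + (-(g z u v / g z u u)) • u) (v + (-(g z u v / g z u u)) • u) := by
  have h0 := (hg.pos z hz u hu).ne'
  have h1 := hg.symm z hz v u
  simp only [map_add, map_smul, add_apply, smul_apply, smul_eq_mul, h1]
  field_simp
  ring

theorem add_smul_ne_zero {u v : E} (h : LinearIndependent ℝ ![u, v]) (c : ℝ) :
    v + c • u ≠ 0 := by
  intro h0
  have := (LinearIndependent.pair_iff.1 h) c 1 (by rw [one_smul, add_comm]; exact h0)
  exact one_ne_zero this.2

theorem gram_pos (hg : IsMetricOn g U) {z : E} (hz : z ∈ U) {u v : E}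
    (h : LinearIndependent ℝ ![u, v]) : 0 < g z u u * g z v v - g z u v ^ 2 := by
  have hu : u ≠ 0 := h.ne_zero 0
  rw [hg.gram_eq hz hu]
  exact mul_pos (hg.pos z hz u hu) (hg.pos z hz _ (add_smul_ne_zero h _))

variable [FiniteDimensional ℝ E]

theorem curvature_eq_christoffelMap (hg : IsMetricOn g U) {z : E} (hz : z ∈ U) (u v w : E) :
    curvature g z u v w =
      fderiv ℝ (christoffelMap g) z u v w - fderiv ℝ (christoffelMap g) z v u w
        + christoffelMap g z u (christoffelMap g z v w)
        - christoffelMap g z v (christoffelMap g z u w) := by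
  have hΓ : DifferentiableAt ℝ (christoffelMap g) z :=
    (hg.contDiffOn_christoffelMap.contDiffAt (hg.isOpen.mem_nhds hz)).differentiableAt (by simp)
  have h := fun a b => (hΓ.hasFDerivAt.clm_apply (hasFDerivAt_const a _)).clm_apply
    (hasFDerivAt_const b _)
  simp only [curvature, ← christoffelMap_apply]
  rw [(h v w).fderiv, (h u w).fderiv]
  simp

theorem contDiffOn_fderiv_christoffelMap (hg : IsMetricOn g U) :
    ContDiffOn ℝ ∞ (fderiv ℝ (christoffelMap g)) U :=
  hg.contDiffOn_christoffelMap.fderiv_of_isOpen hg.isOpen (by simp)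

theorem continuousOn_curvature (hg : IsMetricOn g U) (u v w : E) :
    ContinuousOn (fun z => curvature g z u v w) U := by
  have h1 := hg.contDiffOn_christoffelMap.continuousOn
  have h2 := hg.contDiffOn_fderiv_christoffelMap.continuousOn
  refine ContinuousOn.congr (f := fun z => fderiv ℝ (christoffelMap g) z u v w -
    fderiv ℝ (christoffelMap g) z v u w
        + christoffelMap g z u (christoffelMap g z v w)
        - christoffelMap g z v (christoffelMap g z u w)) ?_
    fun z hz => hg.curvature_eq_christoffelMap hz u v w
  fun_prop

theorem norm_curvature_le (hg : IsMetricOn g U) {z : E} (hz : z ∈ U) (u v w : E) :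
    ‖curvature g z u v w‖ ≤
      (2 * ‖fderiv ℝ (christoffelMap g) z‖ + 2 * ‖christoffelMap g z‖ ^ 2) * ‖u‖ * ‖v‖ * ‖w‖ := by
  have hD : ∀ a b : E, ‖fderiv ℝ (christoffelMap g) z a b w‖ ≤
      ‖fderiv ℝ (christoffelMap g) z‖ * ‖a‖ * ‖b‖ * ‖w‖ := fun a b =>
    (ContinuousLinearMap.le_opNorm _ _).trans
      (mul_le_mul_of_nonneg_right (ContinuousLinearMap.le_opNorm₂ _ _ _) (norm_nonneg _))
  have hΓ : ∀ a b : E, ‖christoffelMap g z a (christoffelMap g z b w)‖ ≤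
      ‖christoffelMap g z‖ * ‖a‖ * (‖christoffelMap g z‖ * ‖b‖ * ‖w‖) := fun a b =>
    (ContinuousLinearMap.le_opNorm₂ _ _ _).trans
      (mul_le_mul_of_nonneg_left (ContinuousLinearMap.le_opNorm₂ _ _ _) (by positivity))
  rw [hg.curvature_eq_christoffelMap hz]
  refine (norm_sub_le _ _).trans ?_
  refine (add_le_add (norm_add_le _ _) le_rfl).trans ?_
  refine (add_le_add (add_le_add (norm_sub_le _ _) le_rfl) le_rfl).trans ?_
  refine (add_le_add (add_le_add (add_le_add (hD u v) (hD v u)) (hΓ u v)) (hΓ v u)).trans ?_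
  exact le_of_eq (by ring)

theorem continuousAt_sectional (hg : IsMetricOn g U) {z : E} (hz : z ∈ U) {u v : E}
    (h : LinearIndependent ℝ ![u, v]) : ContinuousAt (fun x => sectional g x u v) z := by
  have h1 := hg.contDiffOn.continuousOn.continuousAt (hg.isOpen.mem_nhds hz)
  have h2 := (hg.continuousOn_curvature u v v).continuousAt (hg.isOpen.mem_nhds hz)
  have h3 := (hg.gram_pos hz h).ne'
  unfold sectional
  refine ContinuousAt.div ?_ ?_ h3
  · exact (h1.clm_apply h2).clm_apply continuousAt_const
  · fun_prop

/-- Sectional curvatures are locally bounded below. Replacing `v` by its component `w` orthogonal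
to `u` turns the denominator into `g(u, u) g(w, w)`, which dominates `‖u‖ ^ 2 * ‖w‖ ^ 2`, and the
curvature form is bounded by a multiple of the latter. -/
theorem exists_le_sectional (hg : IsMetricOn g U) {y : E} (hy : y ∈ U) :
    ∃ C : ℝ, ∀ᶠ z in 𝓝 y, ∀ u v, LinearIndependent ℝ ![u, v] → C ≤ sectional g z u v := by
  obtain ⟨c, hc, hcz⟩ := hg.exists_pos_le hy
  have hUy := hg.isOpen.mem_nhds hy
  have hK : ContinuousAt (fun z => ‖g z‖ *
      (2 * ‖fderiv ℝ (christoffelMap g) z‖ + 2 * ‖christoffelMap g z‖ ^ 2)) y := by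
    have h1 := hg.contDiffOn.continuousOn.continuousAt hUy
    have h2 := hg.contDiffOn_christoffelMap.continuousOn.continuousAt hUy
    have h3 := hg.contDiffOn_fderiv_christoffelMap.continuousOn.continuousAt hUy
    fun_prop
  set K := ‖g y‖ *
      (2 * ‖fderiv ℝ (christoffelMap g) y‖ + 2 * ‖christoffelMap g y‖ ^ 2) + 1 with hKdef
  have hK0 : 0 ≤ K := by positivity
  have hKz := hK.eventually (gt_mem_nhds (lt_add_one _))
  refine ⟨-(K / c ^ 2), ?_⟩
  filter_upwards [hcz, hKz, hUy] with z hz hKz hzU u v huv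
  have hu : u ≠ 0 := huv.ne_zero 0
  rw [sectional, le_div_iff₀ (hg.gram_pos hzU huv), hg.gram_eq hzU hu,
    ← hg.curvature_add_smul hzU u v (-(g z u v / g z u u))]
  set w := v + (-(g z u v / g z u u)) • u
  have h1 : |g z (curvature g z u w w) u| ≤ K * (‖u‖ ^ 2 * ‖w‖ ^ 2) := by
    refine ((g z).le_opNorm₂ _ _).trans ?_
    have h2 := hg.norm_curvature_le hzU u w w
    calc ‖g z‖ * ‖curvature g z u w w‖ * ‖u‖
        ≤ ‖g z‖ * ((2 * ‖fderiv ℝ (christoffelMap g) z‖ + 2 * ‖christoffelMap g z‖ ^ 2) *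
          ‖u‖ * ‖w‖ * ‖w‖) * ‖u‖ := by gcongr
      _ = (‖g z‖ * (2 * ‖fderiv ℝ (christoffelMap g) z‖ + 2 * ‖christoffelMap g z‖ ^ 2)) *
          (‖u‖ ^ 2 * ‖w‖ ^ 2) := by ring
      _ ≤ K * (‖u‖ ^ 2 * ‖w‖ ^ 2) := by gcongr
  have h2 : c ^ 2 * (‖u‖ ^ 2 * ‖w‖ ^ 2) ≤ g z u u * g z w w := by
    calc c ^ 2 * (‖u‖ ^ 2 * ‖w‖ ^ 2) = (c * ‖u‖ ^ 2) * (c * ‖w‖ ^ 2) := by ring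
      _ ≤ _ := mul_le_mul (hz u) (hz w) (by positivity) (hg.nonneg hzU u)
  have h3 : K * (‖u‖ ^ 2 * ‖w‖ ^ 2) ≤ K / c ^ 2 * (g z u u * g z w w) := by
    calc K * (‖u‖ ^ 2 * ‖w‖ ^ 2) = K / c ^ 2 * (c ^ 2 * (‖u‖ ^ 2 * ‖w‖ ^ 2)) := by field_simp
      _ ≤ _ := by gcongr
  have h4 := neg_le_of_abs_le h1
  linarith

end IsMetricOn

end LocalMetric

/-! ### The metric and the sectional curvature in charts -/

namespace RadialCurvature

open LocalMetric

variable {n : ℕ} {M : Type*} [TopologicalSpace M] [ChartedSpace (EuclideanSpace ℝ (Fin n)) M]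

/-- The derivative of the inverse of the chart around `x₀`, as an endomorphism of the model
space. -/
noncomputable def symmDeriv (x₀ : M) (y : EuclideanSpace ℝ (Fin n)) :
    EuclideanSpace ℝ (Fin n) →L[ℝ] EuclideanSpace ℝ (Fin n) :=
  mfderiv (𝓡 n) (𝓡 n) (extChartAt (𝓡 n) x₀).symm y

/-- The derivative of the chart around `x₀`, as an endomorphism of the model space. -/
noncomputable def chartDeriv (x₀ x : M) :
    EuclideanSpace ℝ (Fin n) →L[ℝ] EuclideanSpace ℝ (Fin n) :=
  mfderiv (𝓡 n) (𝓡 n) (extChartAt (𝓡 n) x₀) x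

section Metric

variable [RiemannianBundle (fun x : M => TangentSpace (𝓡 n) x)]

/-- The inner product of the tangent space at `x`, as a function on pairs of vectors of the model
space. Its type does not depend on `x`, so that the base point can be rewritten. -/
noncomputable def metricAt (x : M) (u v : EuclideanSpace ℝ (Fin n)) : ℝ :=
  inner ℝ (show TangentSpace (𝓡 n) x from u) (show TangentSpace (𝓡 n) x from v)

theorem chartMetric_eq_metricAt (x₀ : M) (y u v : EuclideanSpace ℝ (Fin n)) :
    chartMetric x₀ y u v =
      metricAt ((extChartAt (𝓡 n) x₀).symm y) (symmDeriv x₀ y u) (symmDeriv x₀ y v) := rfl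

theorem sectionalCurvature_eq_sectional (x : M) (u v : EuclideanSpace ℝ (Fin n)) :
    sectionalCurvature (n := n) x u v =
      sectional (chartMetric x) (extChartAt (𝓡 n) x x) (chartDeriv x x u) (chartDeriv x x v) := rfl

end Metric

variable [IsManifold (𝓡 n) ∞ M]

theorem linearIndependent_pair_map {E : Type*} [NormedAddCommGroup E] [NormedSpace ℝ E]
    {A : E →L[ℝ] E} (hA : Function.Injective A) {u v : E} (h : LinearIndependent ℝ ![u, v]) :
    LinearIndependent ℝ ![A u, A v] := by
  rw [LinearIndependent.pair_iff] at h ⊢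
  intro s t hst
  refine h s t (hA ?_)
  simpa using hst

theorem isInvertible_chartDeriv {x₀ x : M} (hx : x ∈ (extChartAt (𝓡 n) x₀).source) :
    (chartDeriv (n := n) x₀ x).IsInvertible := by
  have : IsManifold (𝓡 n) 1 M := .of_le (n := ∞) (by simp)
  exact isInvertible_mfderiv_extChartAt hx

theorem mdifferentiableAt_extChartAt_symm {x₀ : M} {y : EuclideanSpace ℝ (Fin n)}
    (hy : y ∈ (extChartAt (𝓡 n) x₀).target) :
    MDifferentiableAt (𝓡 n) (𝓡 n) (extChartAt (𝓡 n) x₀).symm y :=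
  ((contMDiffOn_extChartAt_symm (n := ∞) x₀).contMDiffAt
    ((isOpen_extChartAt_target x₀).mem_nhds hy)).mdifferentiableAt (by simp)

theorem symmDeriv_injective {x₀ : M} {y : EuclideanSpace ℝ (Fin n)}
    (hy : y ∈ (extChartAt (𝓡 n) x₀).target) : Function.Injective (symmDeriv x₀ y) := by
  have : IsManifold (𝓡 n) 1 M := .of_le (n := ∞) (by simp)
  have h := isInvertible_mfderivWithin_extChartAt_symm (I := 𝓡 n) hy
  rw [modelWithCornersSelf_coe, range_id, mfderivWithin_univ] at h
  exact h.injective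

theorem fderiv_transition {x x₀ : M} (hx : x ∈ (extChartAt (𝓡 n) x₀).source)
    (u : EuclideanSpace ℝ (Fin n)) :
    fderiv ℝ (extChartAt (𝓡 n) x₀ ∘ (extChartAt (𝓡 n) x).symm) (extChartAt (𝓡 n) x x)
      (chartDeriv x x u) = chartDeriv x₀ x u := by
  have : IsManifold (𝓡 n) 1 M := .of_le (n := ∞) (by simp)
  set φ := extChartAt (𝓡 n) x₀ ∘ (extChartAt (𝓡 n) x).symm with hφ
  have hx' : x ∈ (extChartAt (𝓡 n) x).source := mem_extChartAt_source x
  have hd0 : MDifferentiableAt (𝓡 n) (𝓡 n) (extChartAt (𝓡 n) x₀) x :=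
    mdifferentiableAt_extChartAt (by simpa using hx)
  have hd1 : MDifferentiableAt (𝓡 n) (𝓡 n) (extChartAt (𝓡 n) x) x :=
    mdifferentiableAt_extChartAt (mem_chart_source _ x)
  have hl := (extChartAt (𝓡 n) x).left_inv hx'
  have hd : MDifferentiableAt (𝓡 n) (𝓡 n) φ (extChartAt (𝓡 n) x x) := by
    refine MDifferentiableAt.comp _ (by rw [hl]; exact hd0)
      (mdifferentiableAt_extChartAt_symm (mem_extChartAt_target x))
  have h1 := mfderiv_comp x hd hd1
  have h2 : extChartAt (𝓡 n) x₀ =ᶠ[𝓝 x] φ ∘ extChartAt (𝓡 n) x := by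
    filter_upwards [(isOpen_extChartAt_source x).mem_nhds hx'] with y hy
    simp only [hφ, Function.comp_apply, (extChartAt (𝓡 n) x).left_inv hy]
  have h4 : chartDeriv x₀ x = ContinuousLinearMap.comp
      (mfderiv (𝓡 n) (𝓡 n) φ (extChartAt (𝓡 n) x x) : _ →L[ℝ] _) (chartDeriv x x) :=
    (h2.mfderiv_eq (I := 𝓡 n) (I' := 𝓡 n)).trans h1
  rw [h4, mfderiv_eq_fderiv]
  rfl

variable [RiemannianBundle (fun x : M => TangentSpace (𝓡 n) x)]

/-- The metric in a chart is a smooth Riemannian metric on the target of the chart. -/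
theorem isMetricOn_chartMetric [IsContMDiffRiemannianBundle (𝓡 n) ∞ (EuclideanSpace ℝ (Fin n))
      (fun x : M => TangentSpace (𝓡 n) x)] (x₀ : M) :
    IsMetricOn (chartMetric x₀) (extChartAt (𝓡 n) x₀).target where
  isOpen := isOpen_extChartAt_target x₀
  symm z _ u v := real_inner_comm (F := TangentSpace (𝓡 n) ((extChartAt (𝓡 n) x₀).symm z)) _ _
  pos z hz u hu := by
    have h : symmDeriv x₀ z u ≠ 0 := fun h0 =>
      hu (symmDeriv_injective hz (h0.trans (map_zero _).symm))
    exact real_inner_self_pos (F := TangentSpace (𝓡 n) ((extChartAt (𝓡 n) x₀).symm z)) |>.2 h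
  contDiffOn := by
    have hopen := isOpen_extChartAt_target (I := 𝓡 n) x₀
    have hsec : ∀ u : EuclideanSpace ℝ (Fin n),
        ContMDiffOn (𝓡 n) (𝓡 n).tangent ∞ (fun y => (⟨(extChartAt (𝓡 n) x₀).symm y,
          symmDeriv x₀ y u⟩ : TangentBundle (𝓡 n) M)) (extChartAt (𝓡 n) x₀).target := by
      intro u
      have h1 := (contMDiffOn_extChartAt_symm (I := 𝓡 n) (n := ∞) x₀).contMDiffOn_tangentMapWithin
        (m := ∞) (by simp) hopen.uniqueMDiffOn
      have h2 : ContMDiff (𝓡 n) (𝓡 n).tangent ∞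
          (fun y => (⟨y, u⟩ : TangentBundle (𝓡 n) (EuclideanSpace ℝ (Fin n)))) := by
        exact contMDiff_vectorSpace_iff_contDiff.2 contDiff_const
      refine (h1.comp (h2.contMDiffOn (s := (extChartAt (𝓡 n) x₀).target))
        fun y hy => hy).congr ?_
      intro y hy
      simp only [Function.comp_apply, tangentMapWithin, symmDeriv]
      rw [mfderivWithin_of_isOpen hopen hy]
      rfl
    rw [contDiffOn_clm_apply]
    intro u
    rw [contDiffOn_clm_apply]
    intro v
    rw [← contMDiffOn_iff_contDiffOn]
    exact (hsec u).inner_bundle (hsec v)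

/-- The transition maps between two charts are isometries for the metrics in these charts. -/
theorem isLocalIsometryOn_transition
    [IsContMDiffRiemannianBundle (𝓡 n) ∞ (EuclideanSpace ℝ (Fin n))
      (fun x : M => TangentSpace (𝓡 n) x)] (x x₀ : M) :
    IsLocalIsometryOn (extChartAt (𝓡 n) x₀ ∘ (extChartAt (𝓡 n) x).symm)
      (chartMetric x) (chartMetric x₀)
      ((extChartAt (𝓡 n) x).target ∩ (extChartAt (𝓡 n) x).symm ⁻¹' (extChartAt (𝓡 n) x₀).source)
      (extChartAt (𝓡 n) x₀).target := by
  set φ := extChartAt (𝓡 n) x₀ ∘ (extChartAt (𝓡 n) x).symm with hφ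
  set U := (extChartAt (𝓡 n) x).target ∩
    (extChartAt (𝓡 n) x).symm ⁻¹' (extChartAt (𝓡 n) x₀).source with hU
  have hUo : IsOpen U := (continuousOn_extChartAt_symm x).isOpen_inter_preimage
    (isOpen_extChartAt_target x) (isOpen_extChartAt_source x₀)
  have hsmooth : ContDiffOn ℝ ∞ φ U := by
    rw [← contMDiffOn_iff_contDiffOn]
    refine (contMDiffOn_extChartAt (n := ∞) (x := x₀)).comp
      ((contMDiffOn_extChartAt_symm (n := ∞) x).mono inter_subset_left) ?_
    intro y hy
    simpa using hy.2
  have hmaps : MapsTo φ U (extChartAt (𝓡 n) x₀).target := fun y hy =>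
    (extChartAt (𝓡 n) x₀).map_source hy.2
  refine ⟨(isMetricOn_chartMetric x).mono inter_subset_left hUo, isMetricOn_chartMetric x₀,
    hsmooth, hmaps, fun z hz u v => ?_⟩
  have hleft : (extChartAt (𝓡 n) x₀).symm (φ z) = (extChartAt (𝓡 n) x).symm z :=
    (extChartAt (𝓡 n) x₀).left_inv hz.2
  -- the chain rule for `(extChartAt x).symm = (extChartAt x₀).symm ∘ φ`
  have hchain : ∀ w, symmDeriv x z w = symmDeriv x₀ (φ z) (fderiv ℝ φ z w) := by
    intro w
    have hd : MDifferentiableAt (𝓡 n) (𝓡 n) φ z :=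
      ((hsmooth.contDiffAt (hUo.mem_nhds hz)).differentiableAt (by simp)).mdifferentiableAt
    have h1 := mfderiv_comp z (mdifferentiableAt_extChartAt_symm (hmaps hz)) hd
    have h2 : (extChartAt (𝓡 n) x).symm =ᶠ[𝓝 z] (extChartAt (𝓡 n) x₀).symm ∘ φ := by
      filter_upwards [hUo.mem_nhds hz] with y hy
      exact ((extChartAt (𝓡 n) x₀).left_inv hy.2).symm
    have h3 := h2.mfderiv_eq (I := 𝓡 n) (I' := 𝓡 n)
    have h4 : symmDeriv x z =
        (symmDeriv x₀ (φ z)).comp (mfderiv (𝓡 n) (𝓡 n) φ z : _ →L[ℝ] _) := h3.trans h1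
    rw [h4, mfderiv_eq_fderiv]
    rfl
  rw [chartMetric_eq_metricAt, chartMetric_eq_metricAt, hleft, hchain, hchain]

variable [IsContMDiffRiemannianBundle (𝓡 n) ∞ (EuclideanSpace ℝ (Fin n))
      (fun x : M => TangentSpace (𝓡 n) x)]

/-- The sectional curvature at `x` can be computed in any chart around `x`. -/
theorem sectionalCurvature_eq_of_mem_source {x x₀ : M} (hx : x ∈ (extChartAt (𝓡 n) x₀).source)
    (u v : EuclideanSpace ℝ (Fin n)) :
    sectionalCurvature (n := n) x u v =
      sectional (chartMetric x₀) (extChartAt (𝓡 n) x₀ x) (chartDeriv x₀ x u)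
        (chartDeriv x₀ x v) := by
  have hl := (extChartAt (𝓡 n) x).left_inv (mem_extChartAt_source x)
  rw [sectionalCurvature_eq_sectional, (isLocalIsometryOn_transition x x₀).sectional_eq
    ⟨mem_extChartAt_target x, by rw [mem_preimage, hl]; exact hx⟩, fderiv_transition hx,
    fderiv_transition hx, Function.comp_apply, hl]

theorem exists_eventually_le_sectionalCurvature (x₀ : M) :
    ∃ C : ℝ, ∀ᶠ x in 𝓝 x₀, ∀ u v : TangentSpace (𝓡 n) x, LinearIndependent ℝ ![u, v] →
      C ≤ sectionalCurvature x u v := by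
  obtain ⟨C, hC⟩ := (isMetricOn_chartMetric x₀).exists_le_sectional
    (mem_extChartAt_target (I := 𝓡 n) x₀)
  refine ⟨C, ?_⟩
  filter_upwards [(continuousAt_extChartAt x₀).eventually hC,
    (isOpen_extChartAt_source (I := 𝓡 n) x₀).mem_nhds (mem_extChartAt_source (I := 𝓡 n) x₀)]
    with x hx hxs u v huv
  refine le_of_le_of_eq (hx _ _ ?_) (sectionalCurvature_eq_of_mem_source hxs u v).symm
  exact linearIndependent_pair_map (isInvertible_chartDeriv hxs).injective huv

end RadialCurvature

/-! ### The points on minimal geodesics from a base point -/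

section Compactness

variable {M : Type*} [MetricSpace M] [CompleteSpace M] [LocallyCompactSpace M]

/-- Let `S r`, `0 ≤ r`, be sets that grow with `r`, starting from a point, such that every point of
`S r` is within `r - s` of `S s` for `s ≤ r`. Then the sets `S r` are relatively compact, in a
complete locally compact space. The set of `r` such that `S r` is relatively compact is closed,
because a set within `ε` of a totally bounded set for all `ε` is totally bounded, and it is open,
because a thickening of a compact set is relatively compact. -/
theorem isCompact_closure_of_dist_le {S : ℝ → Set M} (hmono : Monotone S)
    (h0 : (S 0).Subsingleton)
    (hS : ∀ s r, 0 ≤ s → s ≤ r → ∀ x ∈ S r, ∃ y ∈ S s, dist x y ≤ r - s) (r : ℝ) :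
    IsCompact (closure (S r)) := by
  have hdown : ∀ s r, s ≤ r → IsCompact (closure (S r)) → IsCompact (closure (S s)) :=
    fun s r hsr h => h.of_isClosed_subset isClosed_closure (closure_mono (hmono hsr))
  have hzero : IsCompact (closure (S 0)) := h0.finite.isCompact.closure
  by_cases hr : r ≤ 0
  · exact hdown r 0 hr hzero
  by_contra hbad
  push Not at hr
  set T := {s : ℝ | 0 ≤ s ∧ IsCompact (closure (S s))} with hT
  have hTne : T.Nonempty := ⟨0, le_rfl, hzero⟩
  have hTbdd : BddAbove T := ⟨r, fun s hs => by
    by_contra hlt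
    exact hbad (hdown r s (not_le.1 hlt).le hs.2)⟩
  set R := sSup T with hR
  have hR0 : 0 ≤ R := le_csSup hTbdd ⟨le_rfl, hzero⟩
  have hbelow : ∀ s < R, IsCompact (closure (S s)) := by
    intro s hs
    obtain ⟨t, ht, hst⟩ := exists_lt_of_lt_csSup hTne hs
    exact hdown s t hst.le ht.2
  -- the set of good parameters is closed
  have hRgood : IsCompact (closure (S R)) := by
    rcases hR0.eq_or_lt with hR0' | hRpos
    · rwa [← hR0']
    refine isCompact_iff_totallyBounded_isComplete.2
      ⟨TotallyBounded.closure ?_, isClosed_closure.isComplete⟩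
    rw [Metric.totallyBounded_iff]
    intro ε hε
    set s := max 0 (R - ε / 2)
    have hsR : s < R := max_lt hRpos (by linarith)
    obtain ⟨t, htf, ht⟩ := Metric.totallyBounded_iff.1
      ((hbelow s hsR).totallyBounded.subset subset_closure) (ε / 2) (half_pos hε)
    refine ⟨t, htf, fun x hx => ?_⟩
    obtain ⟨y, hy, hxy⟩ := hS s R (le_max_left _ _) hsR.le x hx
    obtain ⟨z, hz, hyz⟩ := mem_iUnion₂.1 (ht hy)
    refine mem_iUnion₂.2 ⟨z, hz, ?_⟩
    have h1 : R - ε / 2 ≤ s := le_max_right _ _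
    rw [Metric.mem_ball] at hyz ⊢
    linarith [dist_triangle x y z]
  -- and it is open
  obtain ⟨K, hK, hSK⟩ := exists_compact_superset hRgood
  obtain ⟨δ, hδ, hδK⟩ := hRgood.exists_cthickening_subset_open isOpen_interior hSK
  have hmem : R + δ ∈ T := by
    refine ⟨by linarith, hK.of_isClosed_subset isClosed_closure
      (closure_minimal (fun x hx => ?_) hK.isClosed)⟩
    obtain ⟨y, hy, hxy⟩ := hS R (R + δ) hR0 (by linarith) x hx
    refine interior_subset (hδK ?_)
    exact Metric.mem_cthickening_of_dist_le x y δ _ (subset_closure hy) (by linarith)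
  have := le_csSup hTbdd hmem
  linarith

end Compactness

namespace RadialCurvature

variable {n : ℕ} {M : Type*} [MetricSpace M]
    [ChartedSpace (EuclideanSpace ℝ (Fin n)) M] [IsManifold (𝓡 n) ∞ M]
    [RiemannianBundle (fun x : M => TangentSpace (𝓡 n) x)]

/-- The points at distance at most `r` from `p` that lie on unit speed minimal geodesics
from `p`. -/
def geodesicBall (n : ℕ) {M : Type*} [MetricSpace M]
    [ChartedSpace (EuclideanSpace ℝ (Fin n)) M] [IsManifold (𝓡 n) ∞ M]
    [RiemannianBundle (fun x : M => TangentSpace (𝓡 n) x)] (p : M) (r : ℝ) : Set M :=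
  {x | ∃ γ a, IsUnitSpeedMinimalGeodesic n γ a ∧ γ 0 = p ∧ ∃ t ∈ Ico 0 a, t ≤ r ∧ γ t = x}

theorem isCompact_closure_geodesicBall [CompleteSpace M] (p : M) (r : ℝ) :
    IsCompact (closure (geodesicBall n p r)) := by
  have : LocallyCompactSpace M := ChartedSpace.locallyCompactSpace (EuclideanSpace ℝ (Fin n)) M
  refine isCompact_closure_of_dist_le ?_ ?_ ?_ r
  · rintro r s hrs x ⟨γ, a, hγ, h0, t, ht, htr, rfl⟩
    exact ⟨γ, a, hγ, h0, t, ht, htr.trans hrs, rfl⟩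
  · rintro x ⟨γ, a, hγ, h0, t, ht, htr, rfl⟩ y ⟨γ', a', hγ', h0', t', ht', htr', rfl⟩
    rw [le_antisymm htr ht.1, le_antisymm htr' ht'.1, h0, h0']
  · rintro s r hs hsr x ⟨γ, a, hγ, h0, t, ht, htr, rfl⟩
    have hmin : min t s ∈ Ico 0 a := ⟨le_min ht.1 hs, (min_le_left _ _).trans_lt ht.2⟩
    refine ⟨γ (min t s), ⟨γ, a, hγ, h0, _, hmin, min_le_right _ _, rfl⟩, ?_⟩
    rw [hγ.minimal t ht _ hmin, abs_of_nonneg (by linarith [min_le_left t s])]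
    rcases le_total t s with h | h
    · rw [min_eq_left h]; linarith
    · rw [min_eq_right h]; linarith

/-- Along the minimal geodesics from `p`, the sectional curvature is bounded below in terms of the
distance from `p`. -/
theorem exists_le_sectionalCurvature_of_isUnitSpeedMinimalGeodesic
    [IsContMDiffRiemannianBundle (𝓡 n) ∞ (EuclideanSpace ℝ (Fin n))
      (fun x : M => TangentSpace (𝓡 n) x)] [CompleteSpace M] (p : M) (r : ℝ) :
    ∃ C : ℝ, ∀ (γ : ℝ → M) (a : ℝ), IsUnitSpeedMinimalGeodesic n γ a → γ 0 = p →
      ∀ t ∈ Ico 0 a, t ≤ r → ∀ u v : TangentSpace (𝓡 n) (γ t), LinearIndependent ℝ ![u, v] →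
        C ≤ sectionalCurvature (γ t) u v := by
  have hK := isCompact_closure_geodesicBall (n := n) p r
  obtain ⟨C, hC⟩ : ∃ C : ℝ, ∀ x ∈ closure (geodesicBall n p r), ∀ u v : TangentSpace (𝓡 n) x,
      LinearIndependent ℝ ![u, v] → C ≤ sectionalCurvature x u v := by
    refine hK.induction_on (p := fun s => ∃ C : ℝ, ∀ x ∈ s, ∀ u v : TangentSpace (𝓡 n) x,
      LinearIndependent ℝ ![u, v] → C ≤ sectionalCurvature x u v) ?_ ?_ ?_ ?_
    · exact ⟨0, fun x hx => hx.elim⟩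
    · rintro s t hst ⟨C, hC⟩
      exact ⟨C, fun x hx => hC x (hst hx)⟩
    · rintro s t ⟨C, hC⟩ ⟨C', hC'⟩
      refine ⟨min C C', fun x hx u v huv => ?_⟩
      rcases hx with hx | hx
      · exact (min_le_left _ _).trans (hC x hx u v huv)
      · exact (min_le_right _ _).trans (hC' x hx u v huv)
    · intro x _
      obtain ⟨C, hC⟩ := exists_eventually_le_sectionalCurvature (n := n) x
      exact ⟨_, mem_nhdsWithin_of_mem_nhds hC, C, fun y hy => hy⟩
  exact ⟨C, fun γ a hγ h0 t ht htr => hC _ (subset_closure ⟨γ, a, hγ, h0, t, ht, htr, rfl⟩)⟩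

end RadialCurvature

/-! ### Warping functions of fast growth -/

namespace RadialCurvature

theorem hasDerivAt_comp_sq {h : ℝ → ℝ} {h' t : ℝ} (hh : HasDerivAt h h' (t ^ 2)) :
    HasDerivAt (fun x => h (x ^ 2)) (h' * (2 * t)) t := by
  have h2 : HasDerivAt (fun x : ℝ => x ^ 2) (2 * t) t := by simpa using hasDerivAt_pow 2 t
  exact HasDerivAt.comp (h₂ := h) (h := fun x => x ^ 2) t hh h2

/-- A smooth function `a`, nonnegative on `[0, ∞)`, from which a rotationally symmetric metric on
the plane is built: the warping function of the metric is `t ↦ t * (1 + t ^ 2 * a (t ^ 2))`. -/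
structure Profile where
  /-- The underlying function. -/
  a : ℝ → ℝ
  contDiff : ContDiff ℝ ∞ a
  nonneg : ∀ s, 0 ≤ s → 0 ≤ a s

namespace Profile

variable (P : Profile)

/-- The quotient `f t / t` of the warping function by the radius, as a function of `s = t ^ 2`. -/
def ratio (s : ℝ) : ℝ := 1 + s * P.a s

/-- The warping function of the metric `dt² + f(t)² dθ²`. -/
def warp (t : ℝ) : ℝ := t * P.ratio (t ^ 2)

/-- The Gaussian curvature `-f'' / f` of the metric `dt² + f(t)² dθ²`, written in terms of the
ratio `b` as `-(6 b' + 4 s b'') / b` at `s = t ^ 2`, so that it is smooth at `0`. -/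
noncomputable def curv (t : ℝ) : ℝ :=
  -(6 * deriv P.ratio (t ^ 2) + 4 * t ^ 2 * deriv (deriv P.ratio) (t ^ 2)) / P.ratio (t ^ 2)

theorem contDiff_ratio : ContDiff ℝ ∞ P.ratio :=
  contDiff_const.add (contDiff_id.mul P.contDiff)

theorem contDiff_deriv_ratio : ContDiff ℝ ∞ (deriv P.ratio) :=
  (contDiff_infty_iff_deriv.1 P.contDiff_ratio).2

theorem contDiff_deriv_deriv_ratio : ContDiff ℝ ∞ (deriv (deriv P.ratio)) :=
  (contDiff_infty_iff_deriv.1 P.contDiff_deriv_ratio).2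

theorem ratio_pos {s : ℝ} (hs : 0 ≤ s) : 0 < P.ratio s :=
  add_pos_of_pos_of_nonneg one_pos (mul_nonneg hs (P.nonneg s hs))

theorem contDiff_warp : ContDiff ℝ ∞ P.warp :=
  contDiff_id.mul (P.contDiff_ratio.comp (contDiff_id.pow 2))

theorem warp_neg (t : ℝ) : P.warp (-t) = -P.warp t := by
  simp [warp]

theorem warp_pos {t : ℝ} (ht : 0 < t) : 0 < P.warp t :=
  mul_pos ht (P.ratio_pos (sq_nonneg t))

theorem contDiff_curv : ContDiff ℝ ∞ P.curv := by
  have h2 : ContDiff ℝ ∞ (fun t : ℝ => t ^ 2) := contDiff_id.pow 2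
  have hb := P.contDiff_ratio.comp h2
  have hb1 := P.contDiff_deriv_ratio.comp h2
  have hb2 := P.contDiff_deriv_deriv_ratio.comp h2
  refine ContDiff.div ?_ hb fun t => (P.ratio_pos (sq_nonneg t)).ne'
  exact ((contDiff_const.mul hb1).add ((contDiff_const.mul h2).mul hb2)).neg

theorem hasDerivAt_warp (t : ℝ) :
    HasDerivAt P.warp (P.ratio (t ^ 2) + 2 * t ^ 2 * deriv P.ratio (t ^ 2)) t := by
  have hb : HasDerivAt P.ratio (deriv P.ratio (t ^ 2)) (t ^ 2) :=
    (P.contDiff_ratio.differentiable (by simp) _).hasDerivAt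
  have h := (hasDerivAt_id t).mul (hasDerivAt_comp_sq hb)
  refine h.congr_deriv ?_
  simp
  ring

/-- The Jacobi equation `f'' = -K f`. -/
theorem hasDerivAt_deriv_warp (t : ℝ) :
    HasDerivAt (deriv P.warp) (-P.curv t * P.warp t) t := by
  have e : deriv P.warp = fun t => P.ratio (t ^ 2) + 2 * t ^ 2 * deriv P.ratio (t ^ 2) :=
    funext fun t => (P.hasDerivAt_warp t).deriv
  have hb : HasDerivAt P.ratio (deriv P.ratio (t ^ 2)) (t ^ 2) :=
    (P.contDiff_ratio.differentiable (by simp) _).hasDerivAt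
  have hb1 : HasDerivAt (deriv P.ratio) (deriv (deriv P.ratio) (t ^ 2)) (t ^ 2) :=
    (P.contDiff_deriv_ratio.differentiable (by simp) _).hasDerivAt
  rw [e]
  have h := (hasDerivAt_comp_sq hb).add
    (((hasDerivAt_pow 2 t).const_mul 2).mul (hasDerivAt_comp_sq hb1))
  refine h.congr_deriv ?_
  have hne := (P.ratio_pos (sq_nonneg t)).ne'
  simp [curv, warp]
  field_simp
  ring

/-- There are warping functions with arbitrarily negative curvature at infinity. With `a = exp A`
and `b = 1 + s a`, one has `b' = exp A * (1 + s A')`, which is at least `μ * b` as soon as `μ ≤ A`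
and `μ ≤ A'`, and `b'' ≥ 0` as soon as `A'` and `A''` are nonnegative. An iterated integral
`A` of a smooth function larger than `μ`, over intervals that contain `[s, s + 1]`, has these
properties. -/
theorem exists_curv_le {μ : ℝ → ℝ} (hμ : Monotone μ) (hμ0 : ∀ s, 0 ≤ μ s) :
    ∃ P : Profile, ∀ t, P.curv t ≤ -μ (t ^ 2) := by
  obtain ⟨χ, hχ⟩ := exists_contMDiffMap_forall_mem_convex_of_local_const (n := ⊤) 𝓘(ℝ, ℝ)
    (t := fun s : ℝ => Ici (μ s)) (fun s => convex_Ici _) fun s =>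
      ⟨μ (s + 1), by
        filter_upwards [Iio_mem_nhds (lt_add_one s)] with r hr using hμ hr.le⟩
  have hχs : ContDiff ℝ ∞ χ := contMDiff_iff_contDiff.1 χ.contMDiff
  have hχ' : ∀ s, μ s ≤ χ s := hχ
  have hχ0 : ∀ s, 0 ≤ χ s := fun s => (hμ0 s).trans (hχ' s)
  -- integrating up to `s + 1` a function at least `μ` gives again such a function
  have key : ∀ ρ : ℝ → ℝ, ContDiff ℝ ∞ ρ → (∀ s, 0 ≤ s → μ s ≤ ρ s) →
      (∀ s, HasDerivAt (fun s => ∫ x in (0 : ℝ)..(s + 1), ρ x) (ρ (s + 1)) s) ∧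
      ContDiff ℝ ∞ (fun s => ∫ x in (0 : ℝ)..(s + 1), ρ x) ∧
      ∀ s, 0 ≤ s → μ s ≤ ∫ x in (0 : ℝ)..(s + 1), ρ x := by
    intro ρ hρ hρμ
    have hd : ∀ s, HasDerivAt (fun s => ∫ x in (0 : ℝ)..(s + 1), ρ x) (ρ (s + 1)) s := by
      intro s
      have h := intervalIntegral.integral_hasDerivAt_right (a := 0) (b := s + 1) (f := ρ)
        (hρ.continuous.intervalIntegrable _ _)
        hρ.continuous.stronglyMeasurable.stronglyMeasurableAtFilter hρ.continuous.continuousAt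
      simpa using h.comp_add_const s 1
    refine ⟨hd, ?_, fun s hs => ?_⟩
    · rw [contDiff_infty_iff_deriv]
      refine ⟨fun s => (hd s).differentiableAt, ?_⟩
      rw [show deriv (fun s => ∫ x in (0 : ℝ)..(s + 1), ρ x) = fun s => ρ (s + 1) from
        funext fun s => (hd s).deriv]
      exact hρ.comp (contDiff_id.add contDiff_const)
    · rw [← intervalIntegral.integral_add_adjacent_intervals
        (hρ.continuous.intervalIntegrable 0 s) (hρ.continuous.intervalIntegrable s (s + 1))]
      have h1 : 0 ≤ ∫ x in (0 : ℝ)..s, ρ x :=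
        intervalIntegral.integral_nonneg hs fun x hx => (hμ0 x).trans (hρμ x hx.1)
      have h2 : ∫ _ in s..(s + 1), μ s ≤ ∫ x in s..(s + 1), ρ x :=
        intervalIntegral.integral_mono_on (by linarith) (by simp)
          (hρ.continuous.intervalIntegrable _ _)
          fun x hx => (hμ hx.1).trans (hρμ x (hs.trans hx.1))
      simp at h2
      linarith
  obtain ⟨hBd, hBs, hBμ⟩ := key χ hχs fun s _ => hχ' s
  set B := fun s => ∫ x in (0 : ℝ)..(s + 1), χ x with hB
  obtain ⟨hAd, hAs, hAμ⟩ := key B hBs hBμ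
  set A := fun s => ∫ x in (0 : ℝ)..(s + 1), B x with hA
  let P : Profile := ⟨fun s => Real.exp (A s), hAs.exp, fun s _ => (Real.exp_pos _).le⟩
  have hb1 : deriv P.ratio = fun s => Real.exp (A s) * (1 + s * B (s + 1)) := by
    ext s
    refine HasDerivAt.deriv ?_
    refine (((hasDerivAt_id s).mul (hAd s).exp).const_add 1).congr_deriv ?_
    simp
    ring
  have hb2 : ∀ s, deriv (deriv P.ratio) s = Real.exp (A s) * (2 * B (s + 1) +
      s * B (s + 1) ^ 2 + s * χ (s + 1 + 1)) := by
    intro s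
    rw [hb1]
    refine HasDerivAt.deriv ?_
    have hB' := (hBd (s + 1)).comp_add_const s 1
    refine ((hAd s).exp.mul (((hasDerivAt_id s).mul hB').const_add 1)).congr_deriv ?_
    simp
    ring
  refine ⟨P, fun t => ?_⟩
  have hs : 0 ≤ t ^ 2 := sq_nonneg t
  have hpos := P.ratio_pos hs
  rw [curv, div_le_iff₀ hpos, hb2, hb1]
  show _ ≤ -μ (t ^ 2) * (1 + t ^ 2 * Real.exp (A (t ^ 2)))
  generalize t ^ 2 = s at *
  have hE := Real.exp_pos (A s)
  have h1 : μ s ≤ Real.exp (A s) :=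
    (hAμ s hs).trans ((le_add_of_nonneg_right one_pos.le).trans (Real.add_one_le_exp _))
  have hBs1 : μ s ≤ B (s + 1) := (hμ (by linarith)).trans (hBμ (s + 1) (by linarith))
  have hB0 : 0 ≤ B (s + 1) := (hμ0 s).trans hBs1
  have h2 : 0 ≤ Real.exp (A s) * (2 * B (s + 1) + s * B (s + 1) ^ 2 + s * χ (s + 1 + 1)) := by
    have := hχ0 (s + 1 + 1)
    positivity
  have h3 : μ s * (1 + s * Real.exp (A s)) ≤ Real.exp (A s) * (1 + s * B (s + 1)) := by
    have := mul_le_mul_of_nonneg_left hBs1 (mul_nonneg hs hE.le)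
    nlinarith
  have h4 : 0 ≤ Real.exp (A s) * (1 + s * B (s + 1)) := by positivity
  have h5 := mul_nonneg hs h2
  nlinarith

end Profile

end RadialCurvature

/-! ### Rotationally symmetric metrics on the plane -/

namespace RadialCurvature

open LocalMetric

/-- The Euclidean plane. -/
abbrev Plane := EuclideanSpace ℝ (Fin 2)

namespace Plane

/-- The coordinate functions. -/
noncomputable abbrev coord (i : Fin 2) : Plane →L[ℝ] ℝ := EuclideanSpace.proj i

/-- The form `x₀ dx₁ - x₁ dx₀`, which is `t² dθ` in polar coordinates. -/
noncomputable def angularForm (x : Plane) : Plane →L[ℝ] ℝ := x 0 • coord 1 - x 1 • coord 0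

theorem angularForm_apply (x u : Plane) : angularForm x u = x 0 * u 1 - x 1 * u 0 := by
  simp [angularForm]

theorem inner_eq (u v : Plane) : inner ℝ u v = u 0 * v 0 + u 1 * v 1 := by
  simp [PiLp.inner_apply, Fin.sum_univ_two, mul_comm]

/-- The metric `dt² + f(t)² dθ²` on the plane with coordinates `(t, θ)`. -/
noncomputable def warpedMetric (f : ℝ → ℝ) (y : Plane) : Plane →L[ℝ] Plane →L[ℝ] ℝ :=
  (coord 0).smulRight (coord 0) + f (y 0) ^ 2 • (coord 1).smulRight (coord 1)

theorem warpedMetric_apply (f : ℝ → ℝ) (y u v : Plane) :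
    warpedMetric f y u v = u 0 * v 0 + f (y 0) ^ 2 * (u 1 * v 1) := by
  simp [warpedMetric]

/-- The unit vector along the axis `i`. -/
noncomputable abbrev axis (i : Fin 2) : Plane := EuclideanSpace.single i 1

theorem ext_coord {u v : Plane} (h0 : u 0 = v 0) (h1 : u 1 = v 1) : u = v := by
  ext i
  fin_cases i
  · exact h0
  · exact h1

/-- The polar coordinates map `(t, θ) ↦ (t cos θ, t sin θ)`. -/
noncomputable def polar (y : Plane) : Plane :=
  (y 0 * Real.cos (y 1)) • axis 0 + (y 0 * Real.sin (y 1)) • axis 1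

@[simp] theorem polar_zero (y : Plane) : polar y 0 = y 0 * Real.cos (y 1) := by simp [polar]

@[simp] theorem polar_one (y : Plane) : polar y 1 = y 0 * Real.sin (y 1) := by simp [polar]

theorem contDiff_coord (i : Fin 2) : ContDiff ℝ ∞ (fun y : Plane => y i) := (coord i).contDiff

theorem contDiff_polar : ContDiff ℝ ∞ polar := by
  have h0 := contDiff_coord 0
  have h1 := contDiff_coord 1
  exact ((h0.mul h1.cos).smul contDiff_const).add ((h0.mul h1.sin).smul contDiff_const)

theorem hasFDerivAt_coord (i : Fin 2) (y : Plane) :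
    HasFDerivAt (fun y : Plane => y i) (coord i) y := (coord i).hasFDerivAt

theorem fderiv_polar (y u : Plane) : fderiv ℝ polar y u =
    (u 0 * Real.cos (y 1) - y 0 * Real.sin (y 1) * u 1) • axis 0 +
      (u 0 * Real.sin (y 1) + y 0 * Real.cos (y 1) * u 1) • axis 1 := by
  have h0 := hasFDerivAt_coord 0 y
  have h1 := hasFDerivAt_coord 1 y
  have h := ((h0.mul h1.cos).smul_const (axis 0)).add ((h0.mul h1.sin).smul_const (axis 1))
  erw [h.fderiv]
  apply ext_coord <;> simp <;> ring

section Warped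

variable {f : ℝ → ℝ} {U : Set ℝ}

theorem isMetricOn_warpedMetric (hf : ContDiff ℝ ∞ f) (hU : IsOpen U) (hfU : ∀ t ∈ U, 0 < f t) :
    IsMetricOn (warpedMetric f) {y : Plane | y 0 ∈ U} where
  isOpen := hU.preimage (coord 0).continuous
  contDiffOn := by
    refine ContDiff.contDiffOn ?_
    exact contDiff_const.add (((hf.comp (contDiff_coord 0)).pow 2).smul contDiff_const)
  symm z _ u v := by
    simp only [warpedMetric_apply]
    ring
  pos z hz u hu := by
    rw [warpedMetric_apply]
    have hfz : 0 < f (z 0) := hfU _ hz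
    by_cases h0 : u 0 = 0
    · have h1 : u 1 ≠ 0 := fun h1 => hu (ext_coord h0 h1)
      have := mul_self_pos.2 h1
      rw [h0]
      positivity
    · have := mul_self_pos.2 h0
      have h1 := mul_self_nonneg (u 1)
      positivity

theorem fderiv_warpedMetric (hf : ContDiff ℝ ∞ f) (hU : IsOpen U) (hfU : ∀ t ∈ U, 0 < f t)
    {y : Plane} (hy : y 0 ∈ U) (u v w : Plane) :
    fderiv ℝ (warpedMetric f) y u v w = 2 * f (y 0) * deriv f (y 0) * u 0 * (v 1 * w 1) := by
  rw [← (isMetricOn_warpedMetric hf hU hfU).fderiv_apply_apply hy]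
  have h1 : HasDerivAt f (deriv f (y 0)) (y 0) := (hf.differentiable (by simp) _).hasDerivAt
  have h2 := ((((h1.pow 2).comp_hasFDerivAt y (hasFDerivAt_coord 0 y)).mul_const
    (v 1 * w 1)).const_add (v 0 * w 0))
  have e : (fun z : Plane => warpedMetric f z v w) =
      fun z => v 0 * w 0 + (f ^ 2) (z 0) * (v 1 * w 1) := by
    ext z
    simp [warpedMetric_apply]
  rw [e]
  erw [h2.fderiv]
  simp
  ring

/-- The Christoffel symbols `Γ⁰₁₁ = -f f'` and `Γ¹₀₁ = f' / f` of `dt² + f(t)² dθ²`. -/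
theorem christoffel_warpedMetric (hf : ContDiff ℝ ∞ f) (hU : IsOpen U) (hfU : ∀ t ∈ U, 0 < f t)
    {y : Plane} (hy : y 0 ∈ U) (u v : Plane) :
    christoffel (warpedMetric f) y u v =
      (-(f (y 0) * deriv f (y 0)) * (u 1 * v 1)) • axis 0 +
        (deriv f (y 0) / f (y 0) * (u 0 * v 1 + u 1 * v 0)) • axis 1 := by
  have hm := isMetricOn_warpedMetric hf hU hfU
  refine hm.eq_of_forall hy fun w => ?_
  have h := hm.apply_christoffel hy u v w
  simp only [fderiv_warpedMetric hf hU hfU hy] at h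
  refine mul_left_cancel₀ two_ne_zero (h.trans ?_)
  have hne := (hfU _ hy).ne'
  rw [warpedMetric_apply]
  simp
  field_simp
  ring

/-- The sectional curvature `-f'' / f` of `dt² + f(t)² dθ²`. -/
theorem sectional_warpedMetric (hf : ContDiff ℝ ∞ f) (hU : IsOpen U) (hfU : ∀ t ∈ U, 0 < f t)
    {y : Plane} (hy : y 0 ∈ U) {K : ℝ} (hK : HasDerivAt (deriv f) (-K * f (y 0)) (y 0))
    {u v : Plane} (huv : LinearIndependent ℝ ![u, v]) :
    sectional (warpedMetric f) y u v = K := by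
  have hm := isMetricOn_warpedMetric hf hU hfU
  have hne := (hfU _ hy).ne'
  have h1 : HasDerivAt f (deriv f (y 0)) (y 0) := (hf.differentiable (by simp) _).hasDerivAt
  have hΓ : ∀ v w u : Plane, fderiv ℝ (fun z => christoffel (warpedMetric f) z v w) y u =
      (-(deriv f (y 0) ^ 2 - K * f (y 0) ^ 2) * u 0 * (v 1 * w 1)) • axis 0 +
        ((-K * f (y 0) ^ 2 - deriv f (y 0) ^ 2) / f (y 0) ^ 2 * u 0 *
          (v 0 * w 1 + v 1 * w 0)) • axis 1 := by
    intro v w u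
    have e : (fun z => christoffel (warpedMetric f) z v w) =ᶠ[𝓝 y] fun z =>
        ((-(f * deriv f)) (z 0) * (v 1 * w 1)) • axis 0 +
        ((deriv f / f) (z 0) * (v 0 * w 1 + v 1 * w 0)) • axis 1 := by
      filter_upwards [hm.isOpen.mem_nhds hy] with z hz
      exact christoffel_warpedMetric hf hU hfU hz v w
    have h2 := (((h1.mul hK).neg.comp_hasFDerivAt y (hasFDerivAt_coord 0 y)).mul_const
      (v 1 * w 1)).smul_const (axis 0)
    have h3 := (((hK.div h1 hne).comp_hasFDerivAt y (hasFDerivAt_coord 0 y)).mul_const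
      (v 0 * w 1 + v 1 * w 0)).smul_const (axis 1)
    rw [e.fderiv_eq]
    erw [(h2.add h3).fderiv]
    apply ext_coord
    · simp
      ring
    · simp
      ring
  have hgram := (hm.gram_pos hy huv).ne'
  rw [sectional, div_eq_iff hgram]
  simp only [curvature, hΓ, christoffel_warpedMetric hf hU hfU hy, warpedMetric_apply]
  simp
  field_simp
  ring

end Warped

/-- The metric `|dx|² + e(|x|²) (x₀ dx₁ - x₁ dx₀)²` on the plane. -/
noncomputable def rotationMetric (e : ℝ → ℝ) (x : Plane) : Plane →L[ℝ] Plane →L[ℝ] ℝ :=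
  (coord 0).smulRight (coord 0) + (coord 1).smulRight (coord 1) +
    e (x 0 ^ 2 + x 1 ^ 2) • (angularForm x).smulRight (angularForm x)

theorem rotationMetric_apply (e : ℝ → ℝ) (x u v : Plane) :
    rotationMetric e x u v =
      inner ℝ u v + e (x 0 ^ 2 + x 1 ^ 2) * (angularForm x u * angularForm x v) := by
  simp [rotationMetric, inner_eq]

theorem contDiff_rotationMetric {e : ℝ → ℝ} (he : ContDiff ℝ ∞ e) :
    ContDiff ℝ ∞ (rotationMetric e) := by
  have h0 := contDiff_coord 0
  have h1 := contDiff_coord 1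
  have hω : ContDiff ℝ ∞ angularForm :=
    (h0.smul contDiff_const).sub (h1.smul contDiff_const)
  exact contDiff_const.add ((he.comp ((h0.pow 2).add (h1.pow 2))).smul (hω.smulRight hω))

theorem le_rotationMetric {e : ℝ → ℝ} (he : ∀ s, 0 ≤ s → 0 ≤ e s) (x u : Plane) :
    inner ℝ u u ≤ rotationMetric e x u u := by
  rw [rotationMetric_apply]
  have := he (x 0 ^ 2 + x 1 ^ 2) (by positivity)
  have h := mul_self_nonneg (angularForm x u)
  nlinarith [mul_nonneg this h]

theorem isMetricOn_rotationMetric {e : ℝ → ℝ} (he : ContDiff ℝ ∞ e) (he0 : ∀ s, 0 ≤ s → 0 ≤ e s) :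
    IsMetricOn (rotationMetric e) univ where
  isOpen := isOpen_univ
  contDiffOn := (contDiff_rotationMetric he).contDiffOn
  symm z _ u v := by
    rw [rotationMetric_apply, rotationMetric_apply, real_inner_comm, mul_comm (angularForm z u)]
  pos z _ u hu := (real_inner_self_pos.2 hu).trans_le (le_rotationMetric he0 z u)

/-- In polar coordinates, `|dx|² + e(|x|²) (x₀ dx₁ - x₁ dx₀)²` is
`dt² + t² (1 + t² e(t²)) dθ²`. -/
theorem rotationMetric_polar (e : ℝ → ℝ) (y u v : Plane) :
    rotationMetric e (polar y) (fderiv ℝ polar y u) (fderiv ℝ polar y v) =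
      u 0 * v 0 + y 0 ^ 2 * (1 + y 0 ^ 2 * e (y 0 ^ 2)) * (u 1 * v 1) := by
  have hcs := Real.sin_sq_add_cos_sq (y 1)
  have hn : polar y 0 ^ 2 + polar y 1 ^ 2 = y 0 ^ 2 := by
    simp only [polar_zero, polar_one]
    linear_combination y 0 ^ 2 * hcs
  have hω : ∀ u, angularForm (polar y) (fderiv ℝ polar y u) = y 0 ^ 2 * u 1 := by
    intro u
    rw [angularForm_apply, fderiv_polar]
    simp
    linear_combination y 0 ^ 2 * u 1 * hcs
  rw [rotationMetric_apply, hn, hω, hω, inner_eq, fderiv_polar, fderiv_polar]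
  simp
  linear_combination (u 0 * v 0 + y 0 ^ 2 * u 1 * v 1) * hcs

end Plane

namespace Profile

open Plane

variable (P : Profile)

/-- The metric on the plane that reads `dt² + f(t)² dθ²` in polar coordinates, where `f` is the
warping function of the profile. -/
noncomputable def metric : Plane → Plane →L[ℝ] Plane →L[ℝ] ℝ :=
  rotationMetric fun s => 2 * P.a s + s * P.a s ^ 2

theorem contDiff_metric : ContDiff ℝ ∞ P.metric :=
  contDiff_rotationMetric
    ((contDiff_const.mul P.contDiff).add (contDiff_id.mul (P.contDiff.pow 2)))

theorem inner_le_metric (x u : Plane) : inner ℝ u u ≤ P.metric x u u :=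
  le_rotationMetric (fun s hs => by have := P.nonneg s hs; positivity) x u

theorem isMetricOn_metric : IsMetricOn P.metric univ :=
  isMetricOn_rotationMetric
    ((contDiff_const.mul P.contDiff).add (contDiff_id.mul (P.contDiff.pow 2)))
    (fun s hs => by have := P.nonneg s hs; positivity)

theorem metric_polar (y u v : Plane) :
    P.metric (polar y) (fderiv ℝ polar y u) (fderiv ℝ polar y v) =
      warpedMetric P.warp y u v := by
  rw [metric, rotationMetric_polar, warpedMetric_apply, warp, ratio]
  ring

theorem isLocalIsometryOn_polar :
    IsLocalIsometryOn polar (warpedMetric P.warp) P.metric {y : Plane | y 0 ∈ Ioi 0} univ where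
  source := isMetricOn_warpedMetric P.contDiff_warp isOpen_Ioi fun _ ht => P.warp_pos ht
  target := P.isMetricOn_metric
  contDiffOn := contDiff_polar.contDiffOn
  mapsTo _ _ := mem_univ _
  pullback z _ u v := (P.metric_polar z u v).symm

theorem sectional_metric_polar_of_pos {y : Plane} (hy : 0 < y 0) {u v : Plane}
    (huv : LinearIndependent ℝ ![u, v]) :
    sectional P.metric (polar y) u v = P.curv (y 0) := by
  have H := P.isLocalIsometryOn_polar
  obtain ⟨u', rfl⟩ := H.surjective (z := y) hy u
  obtain ⟨v', rfl⟩ := H.surjective (z := y) hy v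
  rw [← H.sectional_eq (z := y) hy]
  refine sectional_warpedMetric P.contDiff_warp isOpen_Ioi (fun _ ht => P.warp_pos ht) hy
    (P.hasDerivAt_deriv_warp _) ?_
  rw [LinearIndependent.pair_iff] at huv ⊢
  intro s t hst
  refine huv s t ?_
  rw [← map_smul, ← map_smul, ← map_add, hst, map_zero]

/-- The Gaussian curvature at the point with polar coordinates `(t, θ)`; at the origin, where the
polar coordinates degenerate, it is obtained by continuity. -/
theorem sectional_metric_polar {y : Plane} (hy : 0 ≤ y 0) {u v : Plane}
    (huv : LinearIndependent ℝ ![u, v]) :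
    sectional P.metric (polar y) u v = P.curv (y 0) := by
  rcases hy.eq_or_lt with h0 | hpos
  swap
  · exact P.sectional_metric_polar_of_pos hpos huv
  have hp : polar y = 0 := by
    apply ext_coord <;> simp [← h0]
  rw [hp, ← h0]
  have hc1 : ContinuousAt (fun x => sectional P.metric x u v) 0 :=
    P.isMetricOn_metric.continuousAt_sectional (mem_univ _) huv
  have hray : Tendsto (fun t : ℝ => polar (t • axis 0)) (𝓝[>] 0) (𝓝 0) := by
    have h : Continuous fun t : ℝ => polar (t • axis 0) :=
      contDiff_polar.continuous.comp (continuous_id.smul continuous_const)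
    have h' := h.tendsto 0
    have : polar ((0 : ℝ) • axis 0) = 0 := by apply ext_coord <;> simp
    rw [this] at h'
    exact h'.mono_left nhdsWithin_le_nhds
  have hc2 : Tendsto P.curv (𝓝[>] 0) (𝓝 (P.curv 0)) :=
    (P.contDiff_curv.continuous.tendsto 0).mono_left nhdsWithin_le_nhds
  refine tendsto_nhds_unique (hc1.tendsto.comp hray) (hc2.congr' ?_)
  filter_upwards [self_mem_nhdsWithin] with t ht
  have hpos : 0 < (t • axis 0 : Plane) 0 := by simpa using ht
  rw [Function.comp_apply, P.sectional_metric_polar_of_pos hpos huv]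
  simp

end Profile

end RadialCurvature

/-! ### The model surface -/

namespace RadialCurvature

open LocalMetric

/-- The plane, as a smooth surface that does not carry the Euclidean metric. -/
def ModelPlane (_ : Profile) : Type := Plane

namespace ModelPlane

variable (P : Profile)

noncomputable instance : TopologicalSpace (ModelPlane P) := inferInstanceAs (TopologicalSpace Plane)

noncomputable instance : ChartedSpace Plane (ModelPlane P) :=
  chartedSpaceSelf Plane

instance : IsManifold (𝓡 2) ∞ (ModelPlane P) := inferInstanceAs (IsManifold (𝓡 2) ∞ Plane)

instance : T3Space (ModelPlane P) := inferInstanceAs (T3Space Plane)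

instance : PreconnectedSpace (ModelPlane P) := inferInstanceAs (PreconnectedSpace Plane)

/-- The metric of the profile, as a family of forms on the tangent spaces. -/
noncomputable def metricForm (x : ModelPlane P) :
    TangentSpace (𝓡 2) x →L[ℝ] TangentSpace (𝓡 2) x →L[ℝ] ℝ :=
  (P.metric x : Plane →L[ℝ] Plane →L[ℝ] ℝ)

theorem contMDiff_metricForm :
    ContMDiff (𝓡 2) ((𝓡 2).prod 𝓘(ℝ, Plane →L[ℝ] Plane →L[ℝ] ℝ)) ∞
      (fun x : ModelPlane P => TotalSpace.mk' (Plane →L[ℝ] Plane →L[ℝ] ℝ) x (metricForm P x)) := by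
  intro x
  rw [contMDiffAt_section]
  have e : (fun y : ModelPlane P => (trivializationAt (Plane →L[ℝ] Plane →L[ℝ] ℝ)
      (fun x : ModelPlane P => TangentSpace (𝓡 2) x →L[ℝ] TangentSpace (𝓡 2) x →L[ℝ] ℝ) x
      ⟨y, metricForm P y⟩).2) = P.metric := by
    -- the trivializations of the tangent bundle of a vector space are the identity
    refine funext fun y => ?_
    refine ContinuousLinearMap.ext fun v => ContinuousLinearMap.ext fun w => ?_
    have h1 := congrArg Prod.snd (hom_trivializationAt_apply (σ := RingHom.id ℝ) (F₁ := Plane)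
      (E₁ := fun x : ModelPlane P => TangentSpace (𝓡 2) x) (F₂ := Plane →L[ℝ] ℝ)
      (E₂ := fun x : ModelPlane P => TangentSpace (𝓡 2) x →L[ℝ] ℝ) x ⟨y, metricForm P y⟩)
    have h2 := inCoordinates_apply_eq₂ (𝕜 := ℝ) (F₁ := Plane) (F₂ := Plane) (F₃ := ℝ)
      (E₁ := fun x : ModelPlane P => TangentSpace (𝓡 2) x)
      (E₂ := fun x : ModelPlane P => TangentSpace (𝓡 2) x)
      (E₃ := Bundle.Trivial (ModelPlane P) ℝ) (x₀ := x) (x := y) (ϕ := metricForm P y) (v := v)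
      (w := w) (mem_univ _) (mem_univ _) (mem_univ _)
    have h3 : ∀ u : Plane, (trivializationAt Plane
        (fun x : ModelPlane P => TangentSpace (𝓡 2) x) x).symm y u = u := fun u =>
      (Trivialization.symmL_apply (R := ℝ) _ (mem_univ _) _).symm.trans <|
      congrArg (fun l : Plane →L[ℝ] Plane => l u)
        (TangentBundle.symmL_model_space (𝕜 := ℝ) (F := Plane) x y)
    refine (congrArg (fun l : Plane →L[ℝ] Plane →L[ℝ] ℝ => l v w) h1).trans (h2.trans ?_)
    rw [h3, h3]
    simp only [Trivial.fiberBundle_trivializationAt', Trivial.linearMapAt_trivialization,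
      LinearMap.id_coe, id_eq]
    rfl
  rw [e]
  exact P.contDiff_metric.contMDiff.contMDiffAt

/-- The metric of the profile, as a Riemannian metric on the surface. -/
noncomputable def riemannianMetric : ContMDiffRiemannianMetric (𝓡 2) ∞ Plane
    (fun x : ModelPlane P => TangentSpace (𝓡 2) x) where
  inner := metricForm P
  symm x v w := P.isMetricOn_metric.symm x (mem_univ _) v w
  pos x v hv := P.isMetricOn_metric.pos x (mem_univ _) v hv
  isVonNBounded x := by
    change Bornology.IsVonNBounded ℝ {v : Plane | P.metric x v v < 1}
    refine (NormedSpace.isVonNBounded_ball ℝ Plane 1).subset fun v hv => ?_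
    have h1 : inner ℝ v v < (1 : ℝ) := (P.inner_le_metric x v).trans_lt hv
    rw [real_inner_self_eq_norm_sq] at h1
    rw [Metric.mem_ball, dist_zero_right]
    exact (sq_lt_one_iff₀ (norm_nonneg _)).1 h1
  contMDiff := contMDiff_metricForm P

noncomputable instance : RiemannianBundle (fun x : ModelPlane P => TangentSpace (𝓡 2) x) :=
  ⟨(riemannianMetric P).toRiemannianMetric⟩

instance : IsContMDiffRiemannianBundle (𝓡 2) ∞ Plane
    (fun x : ModelPlane P => TangentSpace (𝓡 2) x) :=
  ⟨(riemannianMetric P).inner, (riemannianMetric P).contMDiff, fun _ _ _ => rfl⟩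

theorem inner_eq (x : ModelPlane P) (u v : TangentSpace (𝓡 2) x) :
    inner ℝ u v = P.metric x u v := rfl

theorem chartMetric_eq (x : ModelPlane P) : chartMetric x = P.metric := by
  ext y u v
  have h : symmDeriv x y = ContinuousLinearMap.id ℝ Plane := mfderiv_id
  rw [chartMetric_eq_metricAt, h]
  rfl

theorem sectionalCurvature_eq (x : ModelPlane P) (u v : Plane) :
    sectionalCurvature (n := 2) x u v = sectional P.metric x u v := by
  have h : chartDeriv x x = ContinuousLinearMap.id ℝ Plane := mfderiv_id
  rw [sectionalCurvature_eq_sectional, chartMetric_eq, h]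
  rfl

/-- The Riemannian distance; its topology is that of the plane by definition. -/
noncomputable instance : EMetricSpace (ModelPlane P) :=
  haveI : IsContinuousRiemannianBundle Plane (fun x : ModelPlane P => TangentSpace (𝓡 2) x) :=
    ⟨(riemannianMetric P).inner, (riemannianMetric P).contMDiff.continuous, fun _ _ _ => rfl⟩
  EMetricSpace.ofRiemannianMetric (𝓡 2) (ModelPlane P)

/-- Distances are finite: the points at finite distance from a given one form a clopen set. -/
theorem edist_ne_top (x y : ModelPlane P) : edist x y ≠ ⊤ := by
  have h : IsClopen (Metric.eball y (⊤ : ENNReal)) :=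
    ⟨Metric.isClosed_eball_top, Metric.isOpen_eball⟩
  have h2 := h.eq_univ ⟨y, Metric.mem_eball_self (by simp)⟩
  have : x ∈ Metric.eball y (⊤ : ENNReal) := h2 ▸ mem_univ x
  exact (Metric.mem_eball.1 this).ne

noncomputable instance : MetricSpace (ModelPlane P) :=
  EMetricSpace.toMetricSpace (edist_ne_top P)

instance : IsRiemannianManifold (𝓡 2) (ModelPlane P) := ⟨fun _ _ => rfl⟩

theorem enorm_le (x : Plane) (v : TangentSpace (𝓡 2) x) :
    ‖v‖ₑ ≤ ‖(show TangentSpace (𝓡 2) (show ModelPlane P from x) from v)‖ₑ := by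
  rw [← ofReal_norm, ← ofReal_norm, norm_eq_sqrt_real_inner,
    norm_eq_sqrt_real_inner]
  exact ENNReal.ofReal_le_ofReal (Real.sqrt_le_sqrt (P.inner_le_metric x v))

/-- The distance is at least the Euclidean one, since the metric is. -/
theorem edist_le (x y : ModelPlane P) :
    edist (show Plane from x) (show Plane from y) ≤ edist x y := by
  rw [IsRiemannianManifold.out (I := 𝓡 2) x y]
  refine le_of_forall_gt fun r hr => ?_
  obtain ⟨γ, h0, h1, hγ, hlt⟩ := exists_lt_of_riemannianEDist_lt hr
  refine lt_of_le_of_lt ?_ hlt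
  have hγ' : ContMDiffOn 𝓘(ℝ, ℝ) (𝓡 2) 1 (fun t => (show Plane from γ t)) (Icc 0 1) := hγ
  rw [IsRiemannianManifold.out (I := 𝓡 2) (show Plane from x) (show Plane from y)]
  refine (riemannianEDist_le_pathELength hγ' h0 h1 zero_le_one).trans ?_
  rw [pathELength_eq_lintegral_mfderiv_Icc, pathELength_eq_lintegral_mfderiv_Icc]
  exact MeasureTheory.lintegral_mono fun t => enorm_le P (γ t) _

instance : CompleteSpace (ModelPlane P) := by
  refine Metric.complete_of_cauchySeq_tendsto fun u hu => ?_
  have hL : LipschitzWith 1 (fun x : ModelPlane P => (show Plane from x)) := fun x y => by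
    simpa using edist_le P x y
  obtain ⟨a, ha⟩ := cauchySeq_tendsto_of_complete (hL.uniformContinuous.comp_cauchySeq hu)
  exact ⟨a, ha⟩

end ModelPlane

end RadialCurvature

namespace RadialCurvature

open LocalMetric

namespace ModelPlane

variable (P : Profile)

/-- The center of symmetry. -/
noncomputable def origin : ModelPlane P := (0 : Plane)

/-- The identity map, as a diffeomorphism from the plane. -/
noncomputable def diffeo : Diffeomorph (𝓡 2) (𝓡 2) Plane (ModelPlane P) ∞ :=
  (Diffeomorph.refl (𝓡 2) Plane ∞ : Diffeomorph (𝓡 2) (𝓡 2) Plane Plane ∞)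

theorem polarMap_eq (t θ : ℝ) : polarMap (diffeo P) t θ = Plane.polar !₂[t, θ] := by
  refine Plane.ext_coord (u := !₂[t * Real.cos θ, t * Real.sin θ]) ?_ ?_ <;> simp

theorem polarDt_eq (t θ : ℝ) :
    polarDt (diffeo P) t θ = fderiv ℝ Plane.polar !₂[t, θ] (Plane.axis 0) := by
  have e : (fun s => polarMap (diffeo P) s θ) = fun s => Plane.polar !₂[s, θ] :=
    funext fun s => polarMap_eq P s θ
  have hc : HasDerivAt (fun s : ℝ => (!₂[s, θ] : Plane)) (Plane.axis 0) t := by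
    have h := (((hasDerivAt_id t).smul_const (Plane.axis 0)).add
      ((hasDerivAt_const t θ).smul_const (Plane.axis 1)))
    refine (h.congr_deriv (by simp)).congr_of_eventuallyEq (.of_forall fun s => ?_)
    apply Plane.ext_coord <;> simp
  have h := (Plane.contDiff_polar.differentiable (by simp)
    !₂[t, θ]).hasFDerivAt.comp_hasDerivAt t hc
  have h2 : mfderiv 𝓘(ℝ, ℝ) (𝓡 2) (fun s => Plane.polar !₂[s, θ]) t (1 : ℝ) =
      fderiv ℝ Plane.polar !₂[t, θ] (Plane.axis 0) := by
    rw [mfderiv_eq_fderiv]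
    exact h.deriv
  rw [← h2]
  exact congrArg (fun c : ℝ → Plane => (mfderiv 𝓘(ℝ, ℝ) (𝓡 2) c t : ℝ →L[ℝ] Plane) (1 : ℝ)) e

theorem polarDθ_eq (t θ : ℝ) :
    polarDθ (diffeo P) t θ = fderiv ℝ Plane.polar !₂[t, θ] (Plane.axis 1) := by
  have e : (fun s => polarMap (diffeo P) t s) = fun s => Plane.polar !₂[t, s] :=
    funext fun s => polarMap_eq P t s
  have hc : HasDerivAt (fun s : ℝ => (!₂[t, s] : Plane)) (Plane.axis 1) θ := by
    have h := (((hasDerivAt_const θ t).smul_const (Plane.axis 0)).add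
      ((hasDerivAt_id θ).smul_const (Plane.axis 1)))
    refine (h.congr_deriv (by simp)).congr_of_eventuallyEq (.of_forall fun s => ?_)
    apply Plane.ext_coord <;> simp
  have h := (Plane.contDiff_polar.differentiable (by simp)
    !₂[t, θ]).hasFDerivAt.comp_hasDerivAt θ hc
  have h2 : mfderiv 𝓘(ℝ, ℝ) (𝓡 2) (fun s => Plane.polar !₂[t, s]) θ (1 : ℝ) =
      fderiv ℝ Plane.polar !₂[t, θ] (Plane.axis 1) := by
    rw [mfderiv_eq_fderiv]
    exact h.deriv
  rw [← h2]
  exact congrArg (fun c : ℝ → Plane => (mfderiv 𝓘(ℝ, ℝ) (𝓡 2) c θ : ℝ →L[ℝ] Plane) (1 : ℝ)) e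

theorem inner_polarMap (t θ : ℝ) (u v : Plane) :
    inner ℝ (show TangentSpace (𝓡 2) (polarMap (diffeo P) t θ) from
        fderiv ℝ Plane.polar !₂[t, θ] u)
      (show TangentSpace (𝓡 2) (polarMap (diffeo P) t θ) from
        fderiv ℝ Plane.polar !₂[t, θ] v) = u 0 * v 0 + P.warp t ^ 2 * (u 1 * v 1) := by
  have h := P.metric_polar !₂[t, θ] u v
  rw [Plane.warpedMetric_apply] at h
  rw [inner_eq, polarMap_eq]
  exact h

theorem hasPolarMetric : HasPolarMetric (origin P) (diffeo P) P.warp where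
  base := rfl
  smooth := P.contDiff_warp
  odd := P.warp_neg
  pos _ := P.warp_pos
  metric_tt t θ _ := by
    rw [polarDt_eq]
    exact (inner_polarMap P t θ _ _).trans (by simp)
  metric_tθ t θ _ := by
    rw [polarDt_eq, polarDθ_eq]
    exact (inner_polarMap P t θ _ _).trans (by simp)
  metric_θθ t θ _ := by
    rw [polarDθ_eq]
    exact (inner_polarMap P t θ _ _).trans (by simp)

theorem isModelSurfaceWithRadialCurvature :
    IsModelSurfaceWithRadialCurvature (origin P) P.curv := by
  refine ⟨diffeo P, P.warp, hasPolarMetric P, fun t θ ht u v huv => ?_⟩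
  refine (sectionalCurvature_eq P _ u v).trans ?_
  rw [polarMap_eq]
  exact P.sectional_metric_polar (y := !₂[t, θ]) ht huv

end ModelPlane

end RadialCurvature

end

theorem mainTheorem6 (n : ℕ) (M : Type*) [MetricSpace M]
    [ChartedSpace (EuclideanSpace ℝ (Fin n)) M] [IsManifold (𝓡 n) ∞ M]
    [RiemannianBundle (fun x : M => TangentSpace (𝓡 n) x)]
    [IsContMDiffRiemannianBundle (𝓡 n) ∞ (EuclideanSpace ℝ (Fin n))
      (fun x : M => TangentSpace (𝓡 n) x)]
    [IsRiemannianManifold (𝓡 n) M] [CompleteSpace M] [NoncompactSpace M] (p : M) :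
    ∃ G : ℝ → ℝ, LocallyLipschitzOn (Set.Ici 0) G ∧
      ∃ (N : Type) (_ : MetricSpace N) (_ : ChartedSpace (EuclideanSpace ℝ (Fin 2)) N)
        (_ : IsManifold (𝓡 2) ∞ N) (_ : RiemannianBundle (fun x : N => TangentSpace (𝓡 2) x))
        (_ : IsContMDiffRiemannianBundle (𝓡 2) ∞ (EuclideanSpace ℝ (Fin 2))
          (fun x : N => TangentSpace (𝓡 2) x))
        (_ : IsRiemannianManifold (𝓡 2) N) (_ : CompleteSpace N) (q : N),
        RadialCurvature.IsModelSurfaceWithRadialCurvature q G ∧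
        RadialCurvature.RadialCurvatureBoundedBelow n p G := by
  choose C hC using fun k : ℕ =>
    RadialCurvature.exists_le_sectionalCurvature_of_isUnitSpeedMinimalGeodesic (n := n) p k
  -- a nondecreasing function of `s = t ^ 2` that is at least `-C k` when `k` is `⌈t⌉`
  let μ : ℝ → ℝ := fun s => ∑ i ∈ Finset.range (⌈s⌉₊ + 2), |C i|
  have hμ : Monotone μ := fun s t hst =>
    Finset.sum_le_sum_of_subset_of_nonneg
      (Finset.range_mono (Nat.add_le_add_right (Nat.ceil_mono hst) 2)) fun _ _ _ => abs_nonneg _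
  obtain ⟨P, hP⟩ := RadialCurvature.Profile.exists_curv_le hμ fun s =>
    Finset.sum_nonneg fun _ _ => abs_nonneg _
  refine ⟨P.curv, (P.contDiff_curv.of_le (by simp)).locallyLipschitz.locallyLipschitzOn,
    RadialCurvature.ModelPlane P, inferInstance, inferInstance, inferInstance, inferInstance,
    inferInstance, inferInstance, inferInstance, _,
    RadialCurvature.ModelPlane.isModelSurfaceWithRadialCurvature P, ?_⟩
  intro γ a hγ h0 t ht w hw
  refine (hP t).trans (le_trans ?_ (hC ⌈t⌉₊ γ a hγ h0 t ht (Nat.le_ceil t) _ w hw))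
  have hle : ⌈t⌉₊ ≤ ⌈t ^ 2⌉₊ + 1 := by
    rw [Nat.ceil_le]
    push_cast
    have := Nat.le_ceil (t ^ 2)
    nlinarith [sq_nonneg (t - 1)]
  have h1 : |C ⌈t⌉₊| ≤ μ (t ^ 2) :=
    Finset.single_le_sum (f := fun i => |C i|) (fun _ _ => abs_nonneg _)
      (Finset.mem_range.2 (Nat.lt_succ_of_le hle))
  linarith [neg_abs_le (C ⌈t⌉₊)]
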